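/- For $n\in\mathbb N$ consider $n$ qubits with computational basis states $|j\rangle$, $j\in\{0,1\}^n$. Let $h(j)$ be the number of ones of $j$, let $|j_+\rangle$ be the state obtained from $|j\rangle$ by applying a Hadamard gate to every qubit, and for real $\theta>0$ let $$H_0^\theta=\sum_j \min(\theta,h(j))\,|j_+\rangle\langle j_+|,\qquad H_1^\theta=\sum_j \min(\theta,h(j))\,|j\rangle\langle j|,\qquad H_s^\theta=(1-s)H_0^\theta+sH_1^\theta\quad(0\le s\le 1).$$ The minimal gap is the minimum over $s\in[0,1]$ of the difference between the second smallest and the smallest eigenvalue of $H_s^\theta$ (counted with multiplicity). The adiabatic evolution by $H^\theta$ for total time $\tau>0$ starts at time $0$ in the ground state of $H_0^\theta$ and follows the Schrödinger equation $i\,\psi'(t)=H_{t/\tau}^\theta\,\psi(t)$ for $0\le t\le\tau$. Let $\theta=\theta(n)$ and $\tau=\tau(n)$ depend on $n$. The evolution fails if the overlap $|\langle\alpha_1|\psi(\tau)\rangle|$ of the final state with the ground state $\alpha_1$ of $H_1^\theta$ is $o(1/\mathrm{poly}(n))$, that is, $o(n^{-k})$ for every $k$; it succeeds if this overlap is $\Omega(1/\mathrm{poly}(n))$,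 that is, $\Omega(n^{-k})$ for some $k$. (a) Let $c>1$ be a constant. If $0<\theta(n)\le \frac n2-\sqrt{n(\log n)^c}$ for all large $n$, then for every $\tau(n)>0$ with $\tau(n)=O(n^d)$ for some $d$ the adiabatic evolution by $H^{\theta(n)}$ for total time $\tau(n)$ fails. Furthermore, the minimal gap of $H_s^{\theta(n)}$ is $o(1/\mathrm{poly}(n))$. (b) If $\theta(n)\ge \frac n2+\sqrt{40\,n\log n}$ for all large $n$, then the adiabatic evolution by $H^{\theta(n)}$ for total time $\tau(n)=n^4$ succeeds. Here $\log$ is the natural logarithm. -/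

import Mathlib

open Filter Asymptotics
open scoped Matrix

noncomputable section

namespace ThetaAdiabatic

/-- Bit strings of length `n`, i.e. the binary representations of `0, …, 2 ^ n - 1`. -/
abbrev Bits (n : ℕ) : Type := Fin n → Fin 2

/-- The state space of `n` qubits, with its Hilbert space structure. -/
abbrev State (n : ℕ) : Type := EuclideanSpace ℂ (Bits n)

/-- Operators on `n` qubits, as matrices in the computational basis. -/
abbrev Op (n : ℕ) : Type := Matrix (Bits n) (Bits n) ℂ

/-- The Hamming weight `h(j)`: the number of ones of `j`. -/
def weight {n : ℕ} (j : Bits n) : ℕ := (Finset.univ.filter fun i => j i = 1).card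

/-- The truncated Hamming weight `h_θ(j) = min(θ, h(j))`. -/
def truncWeight {n : ℕ} (θ : ℝ) (j : Bits n) : ℝ := min θ (weight j : ℝ)

/-- The computational basis state `|j⟩`. -/
def ket {n : ℕ} (j : Bits n) : Bits n → ℂ := Pi.single j 1

/-- The single-qubit Hadamard gate. -/
def hadamard : Matrix (Fin 2) (Fin 2) ℂ := ((1 / Real.sqrt 2 : ℝ) : ℂ) • !![1, 1; 1, -1]

/-- The state `|j₊⟩`: the Hadamard gate applied to every qubit of `|j⟩`. -/
def ketPlus {n : ℕ} (j : Bits n) : Bits n → ℂ := fun k => ∏ i, hadamard (k i) (j i)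

/-- The operator `|v⟩⟨v|`. -/
def ketbra {n : ℕ} (v : Bits n → ℂ) : Op n := Matrix.vecMulVec v (star v)

/-- `H₀^θ = ∑ⱼ h_θ(j) |j₊⟩⟨j₊|`. -/
def H0 (n : ℕ) (θ : ℝ) : Op n := ∑ j : Bits n, ((truncWeight θ j : ℝ) : ℂ) • ketbra (ketPlus j)

/-- `H₁^θ = ∑ⱼ h_θ(j) |j⟩⟨j|`. -/
def H1 (n : ℕ) (θ : ℝ) : Op n := ∑ j : Bits n, ((truncWeight θ j : ℝ) : ℂ) • ketbra (ket j)

/-- The interpolation `H_s^θ = (1 - s) H₀^θ + s H₁^θ`. -/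
def H (n : ℕ) (θ s : ℝ) : Op n := ((1 - s : ℝ) : ℂ) • H0 n θ + ((s : ℝ) : ℂ) • H1 n θ

theorem isHermitian_sum {n : ℕ} (f : Bits n → ℝ) (v : Bits n → Bits n → ℂ) :
    (∑ j, ((f j : ℝ) : ℂ) • ketbra (v j)).IsHermitian := by
  unfold Matrix.IsHermitian
  rw [Matrix.conjTranspose_sum]
  refine Finset.sum_congr rfl fun j _ => ?_
  simp [ketbra, Matrix.conjTranspose_smul, Matrix.conjTranspose_vecMulVec]

theorem isHermitian_H (n : ℕ) (θ s : ℝ) : (H n θ s).IsHermitian := by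
  have h0 : (H0 n θ)ᴴ = H0 n θ := isHermitian_sum _ _
  have h1 : (H1 n θ)ᴴ = H1 n θ := isHermitian_sum _ _
  unfold Matrix.IsHermitian H
  rw [Matrix.conjTranspose_add, Matrix.conjTranspose_smul, Matrix.conjTranspose_smul, h0, h1]
  simp

/-- The spectral gap of a Hermitian matrix: its second smallest eigenvalue minus its smallest one,
counted with multiplicity (`eigenvalues₀` lists the eigenvalues in decreasing order). -/
def gap {ι : Type*} [Fintype ι] [DecidableEq ι] {A : Matrix ι ι ℂ} (hA : A.IsHermitian) : ℝ :=
  if h : 2 ≤ Fintype.card ι then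
    hA.eigenvalues₀ ⟨Fintype.card ι - 2, by omega⟩ - hA.eigenvalues₀ ⟨Fintype.card ι - 1, by omega⟩
  else 0

/-- The minimal gap of `H_s^θ` over `0 ≤ s ≤ 1`. -/
def minGap (n : ℕ) (θ : ℝ) : ℝ := ⨅ s : Set.Icc (0 : ℝ) 1, gap (isHermitian_H n θ s)

/-- `v` is a ground state of `A`: a unit eigenvector for the smallest eigenvalue. -/
def IsGroundState {n : ℕ} (A : Op n) (v : State n) : Prop :=
  ‖v‖ = 1 ∧ ∃ E : ℝ, A.toEuclideanLin v = (E : ℂ) • v ∧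
    ∀ μ : ℝ, Module.End.HasEigenvalue A.toEuclideanLin (μ : ℂ) → E ≤ μ

/-- `ψ` is the path of the system under `H(t) = H_{t/τ}^θ`, `0 ≤ t ≤ τ`, started in a ground state
of `H₀^θ`: it solves the Schrödinger equation `i ψ'(t) = H(t) ψ(t)`. -/
structure IsAdiabaticEvolution (n : ℕ) (θ τ : ℝ) (ψ : ℝ → State n) : Prop where
  initial : IsGroundState (H0 n θ) (ψ 0)
  schrodinger : ∀ t ∈ Set.Icc (0 : ℝ) τ,
    HasDerivWithinAt ψ (-Complex.I • (H n θ (t / τ)).toEuclideanLin (ψ t)) (Set.Icc 0 τ) t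

/-- The function `f` is `o(1 / poly(n))`: it is `o(n ^ (-k))` for every `k`. -/
def IsNegligible (f : ℕ → ℝ) : Prop :=
  ∀ k : ℕ, f =o[atTop] fun n : ℕ => ((n : ℝ) ^ k)⁻¹

/-- The function `f` is `Ω(1 / poly(n))`: it is `Ω(n ^ (-k))` for some `k`. -/
def IsNoticeable (f : ℕ → ℝ) : Prop :=
  ∃ k : ℕ, (fun n : ℕ => ((n : ℝ) ^ k)⁻¹) =O[atTop] f

/-- The evolution by `H^{θ(n)}` in time `τ(n)` fails: the overlap of the final state with the
ground state of the final Hamiltonian is `o(1 / poly(n))`. -/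
def Fails (θ τ : ℕ → ℝ) : Prop :=
  ∀ (ψ : (n : ℕ) → ℝ → State n) (α₁ : (n : ℕ) → State n),
    (∀ᶠ n in atTop, IsAdiabaticEvolution n (θ n) (τ n) (ψ n)) →
    (∀ᶠ n in atTop, IsGroundState (H1 n (θ n)) (α₁ n)) →
    IsNegligible fun n => ‖inner ℂ (α₁ n) (ψ n (τ n))‖

/-- The evolution by `H^{θ(n)}` in time `τ(n)` succeeds: the overlap of the final state with the
ground state of the final Hamiltonian is `Ω(1 / poly(n))`. -/
def Succeeds (θ τ : ℕ → ℝ) : Prop :=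
  ∀ (ψ : (n : ℕ) → ℝ → State n) (α₁ : (n : ℕ) → State n),
    (∀ᶠ n in atTop, IsAdiabaticEvolution n (θ n) (τ n) (ψ n)) →
    (∀ᶠ n in atTop, IsGroundState (H1 n (θ n)) (α₁ n)) →
    IsNoticeable fun n => ‖inner ℂ (α₁ n) (ψ n (τ n))‖

end ThetaAdiabatic

end

open Filter Asymptotics
open scoped Matrix

noncomputable section

namespace ThetaAdiabatic

/-! ### Product states and the Walsh–Hadamard transform -/

/-! In both regimes an explicit product state solves the Schrödinger equation up to a small
residual. Hermitian generators preserve distances, so a residual of norm at most ε costs at most ετ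
over time τ (`norm_sub_le_of_schrodinger`). The effect of the threshold is controlled by Chernoff
bounds, whose exponential moments factorise over the qubits.

Small θ. Measured in the computational basis, the uniform superposition has weight concentrated near
n/2, above θ, so `H1` acts on it almost as the scalar θ, while `H0` kills it. It is therefore an
approximate eigenvector of every `H n θ s`, with value sθ (`norm_H_plusState_sub_le`). The evolution
only rotates its phase, and its overlap with the target state is 2^(-n/2). The gap must close too
(`minGap_le`): with a uniform gap the ground state moves continuously, so its squared overlap with
the uniform superposition passes through 1/2. There the superposition is split equally between the
ground state and its complement, and both halves must have energy close to sθ.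

Large θ. On product states whose qubits show 1 with probability at most about 1/2, in both the
computational and the Hadamard basis, the threshold is almost invisible (`norm_H_trunc_sub_le`).
Without it the Hamiltonian is a sum of one-qubit terms with gap at least 1/√2, so n copies of a
one-qubit adiabatic approximation suffice. The instantaneous ground state alone leaves a residual of
order 1/τ, which time τ would accumulate to order 1; a first-order correction (`ansatz`) reduces it
to order 1/τ² (`hasDerivAt_ansatz`). -/

theorem sum_prod_bits {R : Type*} [CommSemiring R] {n : ℕ} (f : Fin n → Fin 2 → R) :
    ∑ k : Bits n, ∏ i, f i (k i) = ∏ i, (f i 0 + f i 1) := by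
  simp_rw [← Fin.sum_univ_two]
  exact (Fintype.prod_sum f).symm

/-- The product state with factors `v i`. -/
def tens {n : ℕ} (v : Fin n → Fin 2 → ℂ) : State n := WithLp.toLp 2 fun k => ∏ i, v i (k i)

theorem tens_apply {n : ℕ} (v : Fin n → Fin 2 → ℂ) (k : Bits n) : tens v k = ∏ i, v i (k i) := rfl

theorem norm_sq_tens {n : ℕ} (v : Fin n → Fin 2 → ℂ) :
    ‖tens v‖ ^ 2 = ∏ i, (‖v i 0‖ ^ 2 + ‖v i 1‖ ^ 2) := by
  rw [EuclideanSpace.norm_sq_eq, ← sum_prod_bits fun i b => ‖v i b‖ ^ 2]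
  simp [tens_apply, norm_prod, Finset.prod_pow]

theorem inner_tens {n : ℕ} (u v : Fin n → Fin 2 → ℂ) :
    inner ℂ (tens u) (tens v) = ∏ i, (star (u i 0) * v i 0 + star (u i 1) * v i 1) := by
  rw [← sum_prod_bits fun i b => star (u i b) * v i b, PiLp.inner_apply]
  refine Finset.sum_congr rfl fun k _ => ?_
  simp [tens_apply, Finset.prod_mul_distrib, mul_comm]

/-- The Hadamard gate on every qubit, as a matrix. -/
def walsh (n : ℕ) : Op n := Matrix.of fun k j => ketPlus j k

theorem walsh_tens {n : ℕ} (v : Fin n → Fin 2 → ℂ) :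
    (walsh n).toEuclideanLin (tens v) = tens fun i => hadamard *ᵥ v i := by
  ext k
  have : (∑ j : Bits n, (∏ i, hadamard (k i) (j i)) * ∏ i, v i (j i))
      = ∏ i, (hadamard (k i) 0 * v i 0 + hadamard (k i) 1 * v i 1) := by
    rw [← sum_prod_bits fun i b => hadamard (k i) b * v i b]
    simp [Finset.prod_mul_distrib]
  refine this.trans ?_
  simp only [tens_apply, Matrix.mulVec, dotProduct, Fin.sum_univ_two]

theorem hadamard_mul_self : hadamard * hadamard = 1 := by
  have h : ((1 / Real.sqrt 2 : ℝ) : ℂ) * ((1 / Real.sqrt 2 : ℝ) : ℂ) = 1 / 2 := by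
    rw [← Complex.ofReal_mul]
    have : (1 / Real.sqrt 2 : ℝ) * (1 / Real.sqrt 2) = 1 / 2 := by
      rw [div_mul_div_comm, Real.mul_self_sqrt (by norm_num)]; norm_num
    rw [this]; norm_num
  rw [hadamard, Matrix.smul_mul, Matrix.mul_smul, smul_smul, h]
  ext i j
  fin_cases i <;> fin_cases j <;> simp <;> norm_num

theorem hadamard_symm (i j : Fin 2) : hadamard i j = hadamard j i := by
  fin_cases i <;> fin_cases j <;> simp [hadamard]

theorem star_hadamard (i j : Fin 2) : star (hadamard i j) = hadamard i j := by
  fin_cases i <;> fin_cases j <;> simp [hadamard]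

theorem ketPlus_symm {n : ℕ} (j k : Bits n) : ketPlus j k = ketPlus k j :=
  Finset.prod_congr rfl fun _ _ => hadamard_symm _ _

theorem star_ketPlus {n : ℕ} (j k : Bits n) : star (ketPlus j k) = ketPlus j k := by
  simp only [ketPlus, star_prod, star_hadamard]

theorem walsh_mul_self (n : ℕ) : walsh n * walsh n = 1 := by
  ext k j
  have h : ∀ a b : Fin 2, hadamard a 0 * hadamard 0 b + hadamard a 1 * hadamard 1 b
      = (1 : Matrix (Fin 2) (Fin 2) ℂ) a b := fun a b => by
    rw [← hadamard_mul_self, Matrix.mul_apply, Fin.sum_univ_two]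
  have : ∑ l : Bits n, (∏ i, hadamard (k i) (l i)) * ∏ i, hadamard (l i) (j i)
      = ∏ i, (1 : Matrix (Fin 2) (Fin 2) ℂ) (k i) (j i) := by
    rw [← Finset.prod_congr rfl fun i _ => h (k i) (j i),
      ← sum_prod_bits fun i b => hadamard (k i) b * hadamard b (j i)]
    simp only [Finset.prod_mul_distrib]
  simp only [Matrix.mul_apply, walsh, Matrix.of_apply, ketPlus, this]
  by_cases hkj : k = j
  · subst hkj
    rw [Matrix.one_apply_eq]
    exact Finset.prod_eq_one fun i _ => Matrix.one_apply_eq _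
  · obtain ⟨i, hi⟩ := Function.ne_iff.mp hkj
    rw [Matrix.one_apply_ne hkj]
    exact Finset.prod_eq_zero (Finset.mem_univ i) (Matrix.one_apply_ne hi)

theorem walsh_isHermitian (n : ℕ) : (walsh n).IsHermitian := by
  ext k j
  simp only [walsh, Matrix.conjTranspose_apply, Matrix.of_apply, star_ketPlus, ketPlus_symm k j]

theorem walsh_walsh {n : ℕ} (x : State n) :
    (walsh n).toEuclideanLin ((walsh n).toEuclideanLin x) = x := by
  rw [← LinearMap.comp_apply, ← Matrix.toLpLin_mul_same, walsh_mul_self, Matrix.toLpLin_one,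
    LinearMap.id_apply]

theorem inner_toEuclideanLin {n : ℕ} {A : Op n} (hA : A.IsHermitian) (x y : State n) :
    inner ℂ (A.toEuclideanLin x) y = inner ℂ x (A.toEuclideanLin y) :=
  Matrix.isSymmetric_toEuclideanLin_iff.mpr hA x y

theorem norm_walsh {n : ℕ} (x : State n) : ‖(walsh n).toEuclideanLin x‖ = ‖x‖ := by
  rw [@norm_eq_sqrt_re_inner ℂ, @norm_eq_sqrt_re_inner ℂ _ _ _ _ x,
    inner_toEuclideanLin (walsh_isHermitian n), walsh_walsh]

/-! ### The Hamiltonians -/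

theorem H1_eq_diagonal (n : ℕ) (θ : ℝ) :
    H1 n θ = Matrix.diagonal fun j => ((truncWeight θ j : ℝ) : ℂ) := by
  ext k l
  rw [H1, Matrix.sum_apply]
  simp only [Matrix.smul_apply, ketbra, Matrix.vecMulVec_apply, ket, Pi.star_apply, smul_eq_mul]
  rw [Finset.sum_eq_single k]
  · by_cases h : k = l
    · simp [h]
    · simp [h, Ne.symm h]
  · intro b _ hb
    simp [Pi.single_apply, Ne.symm hb]
  · simp

theorem H0_eq (n : ℕ) (θ : ℝ) : H0 n θ = walsh n * H1 n θ * walsh n := by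
  ext k l
  rw [H0, H1_eq_diagonal, Matrix.sum_apply, Matrix.mul_apply]
  refine Finset.sum_congr rfl fun j _ => ?_
  rw [Matrix.mul_diagonal]
  simp only [Matrix.smul_apply, ketbra, Matrix.vecMulVec_apply, Pi.star_apply, smul_eq_mul,
    star_ketPlus, walsh, Matrix.of_apply, ketPlus_symm l j]
  ring

theorem H1_apply {n : ℕ} (θ : ℝ) (x : State n) (k : Bits n) :
    (H1 n θ).toEuclideanLin x k = ((truncWeight θ k : ℝ) : ℂ) * x k := by
  rw [H1_eq_diagonal, Matrix.toLpLin_apply]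
  exact Matrix.mulVec_diagonal _ _ _

theorem H0_apply {n : ℕ} (θ : ℝ) (x : State n) :
    (H0 n θ).toEuclideanLin x = (walsh n).toEuclideanLin
      ((H1 n θ).toEuclideanLin ((walsh n).toEuclideanLin x)) := by
  rw [H0_eq, Matrix.toLpLin_mul_same, Matrix.toLpLin_mul_same]
  rfl

theorem H_apply {n : ℕ} (θ s : ℝ) (x : State n) :
    (H n θ s).toEuclideanLin x = ((1 - s : ℝ) : ℂ) • (H0 n θ).toEuclideanLin x
      + ((s : ℝ) : ℂ) • (H1 n θ).toEuclideanLin x := by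
  simp only [H, map_add, map_smul, LinearMap.add_apply, LinearMap.smul_apply]

theorem truncWeight_zero {n : ℕ} {θ : ℝ} (hθ : 0 ≤ θ) : truncWeight θ (0 : Bits n) = 0 := by
  simp [truncWeight, weight, hθ]

theorem truncWeight_pos {n : ℕ} {θ : ℝ} (hθ : 0 < θ) {k : Bits n} (hk : k ≠ 0) :
    0 < truncWeight θ k := by
  obtain ⟨i, hi⟩ := Function.ne_iff.mp hk
  have : 0 < weight k := Finset.card_pos.mpr ⟨i, by
    have : k i = 1 := by rcases Fin.exists_fin_two.mp ⟨k i, rfl⟩ with h | h <;> simp_all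
    simp [this]⟩
  exact lt_min hθ (by exact_mod_cast this)

theorem weight_le {n : ℕ} (k : Bits n) : weight k ≤ n :=
  (Finset.card_le_univ _).trans (by simp)

/-- The state `|0…0⟩`. -/
def zeroState (n : ℕ) : State n := tens fun _ => ![1, 0]

/-- The state `|0…0₊⟩`. -/
def plusState (n : ℕ) : State n := (walsh n).toEuclideanLin (zeroState n)

theorem zeroState_zero (n : ℕ) : zeroState n 0 = 1 := by simp [zeroState, tens_apply]

theorem zeroState_of_ne {n : ℕ} {k : Bits n} (hk : k ≠ 0) : zeroState n k = 0 := by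
  obtain ⟨i, hi⟩ := Function.ne_iff.mp hk
  have : k i = 1 := by rcases Fin.exists_fin_two.mp ⟨k i, rfl⟩ with h | h <;> simp_all
  exact Finset.prod_eq_zero (Finset.mem_univ i) (by simp [this])

theorem norm_zeroState (n : ℕ) : ‖zeroState n‖ = 1 := by
  have : ‖zeroState n‖ ^ 2 = 1 := by simp [zeroState, norm_sq_tens]
  nlinarith [norm_nonneg (zeroState n)]

theorem norm_plusState (n : ℕ) : ‖plusState n‖ = 1 := by
  rw [plusState, norm_walsh, norm_zeroState]

theorem walsh_plusState (n : ℕ) : (walsh n).toEuclideanLin (plusState n) = zeroState n :=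
  walsh_walsh _

theorem plusState_eq_tens (n : ℕ) :
    plusState n = tens fun _ => ![((1 / Real.sqrt 2 : ℝ) : ℂ), ((1 / Real.sqrt 2 : ℝ) : ℂ)] := by
  rw [plusState, zeroState, walsh_tens]
  congr 1
  ext i b
  fin_cases b <;> simp [hadamard, Matrix.mulVec, dotProduct, Fin.sum_univ_two]

theorem plusState_apply {n : ℕ} (k : Bits n) : ‖plusState n k‖ ^ 2 = (1 / 2) ^ n := by
  rw [plusState_eq_tens, tens_apply]
  have : ∀ b : Fin 2, (![((1 / Real.sqrt 2 : ℝ) : ℂ), ((1 / Real.sqrt 2 : ℝ) : ℂ)] : Fin 2 → ℂ) b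
      = ((1 / Real.sqrt 2 : ℝ) : ℂ) := fun b => by fin_cases b <;> rfl
  simp only [this, Finset.prod_const, Finset.card_univ, Fintype.card_fin, norm_pow,
    Complex.norm_real]
  rw [← pow_mul, mul_comm, pow_mul, Real.norm_eq_abs, sq_abs, div_pow, Real.sq_sqrt (by norm_num)]
  norm_num

theorem norm_sq_inner_zeroState_plusState (n : ℕ) :
    ‖inner ℂ (zeroState n) (plusState n)‖ ^ 2 = (1 / 2) ^ n := by
  rw [← plusState_apply (0 : Bits n), PiLp.inner_apply, Finset.sum_eq_single 0]
  · simp [zeroState_zero]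
  · intro k _ hk
    simp [zeroState_of_ne hk]
  · simp

theorem H1_zeroState {n : ℕ} {θ : ℝ} (hθ : 0 ≤ θ) :
    (H1 n θ).toEuclideanLin (zeroState n) = 0 := by
  ext k
  rw [H1_apply]
  by_cases hk : k = 0
  · simp [hk, truncWeight_zero hθ]
  · simp [zeroState_of_ne hk]

theorem H0_plusState {n : ℕ} {θ : ℝ} (hθ : 0 ≤ θ) :
    (H0 n θ).toEuclideanLin (plusState n) = 0 := by
  rw [H0_apply, walsh_plusState, H1_zeroState hθ, map_zero]

/-- All diagonal entries away from the zero string are positive, so an eigenvector with `E ≤ 0`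
vanishes there. Asking only for `E ≤ 0` suits ground states, whose energy is bounded above by a test
vector. -/
theorem eq_smul_zeroState_of_eigen {n : ℕ} {θ E : ℝ} (hθ : 0 < θ) (hE : E ≤ 0) {v : State n}
    (hn : ‖v‖ = 1) (hv : (H1 n θ).toEuclideanLin v = (E : ℂ) • v) :
    ∃ c : ℂ, ‖c‖ = 1 ∧ v = c • zeroState n := by
  have h : v = v 0 • zeroState n := by
    ext k
    by_cases hk : k = 0
    · simp [hk, zeroState_zero]
    · have h1 : (((truncWeight θ k : ℝ) : ℂ) - E) * v k = 0 := by
        rw [sub_mul, ← H1_apply, hv]; simp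
      have h2 : ((truncWeight θ k : ℝ) : ℂ) - E ≠ 0 := by
        rw [← Complex.ofReal_sub, Complex.ofReal_ne_zero]
        linarith [truncWeight_pos hθ hk]
      simp [zeroState_of_ne hk, (mul_eq_zero.mp h1).resolve_left h2]
  refine ⟨v 0, ?_, h⟩
  rw [h, norm_smul, norm_zeroState, mul_one] at hn
  exact hn

theorem eq_smul_plusState_of_eigen {n : ℕ} {θ E : ℝ} (hθ : 0 < θ) (hE : E ≤ 0) {v : State n}
    (hn : ‖v‖ = 1) (hv : (H0 n θ).toEuclideanLin v = (E : ℂ) • v) :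
    ∃ c : ℂ, ‖c‖ = 1 ∧ v = c • plusState n := by
  obtain ⟨c, hc, h⟩ := eq_smul_zeroState_of_eigen (v := (walsh n).toEuclideanLin v) hθ hE
    (by rw [norm_walsh, hn])
    (by rw [← map_smul, ← hv, H0_apply, walsh_walsh])
  exact ⟨c, hc, by rw [← walsh_walsh v, h, map_smul, plusState]⟩

theorem IsGroundState.energy_nonpos {n : ℕ} {A : Op n} {v w : State n} (h : IsGroundState A v)
    (hw : ‖w‖ = 1) (hA : A.toEuclideanLin w = 0) :
    ∃ E : ℝ, E ≤ 0 ∧ A.toEuclideanLin v = (E : ℂ) • v := by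
  obtain ⟨-, E, hE, hmin⟩ := h
  refine ⟨E, hmin 0 (Module.End.hasEigenvalue_of_hasEigenvector (x := w) ⟨?_, ?_⟩), hE⟩
  · rw [Module.End.mem_eigenspace_iff, hA]; simp
  · intro h0; simp [h0] at hw

theorem IsGroundState.eq_smul_zeroState {n : ℕ} {θ : ℝ} (hθ : 0 < θ) {v : State n}
    (h : IsGroundState (H1 n θ) v) : ∃ c : ℂ, ‖c‖ = 1 ∧ v = c • zeroState n := by
  obtain ⟨E, hE, hv⟩ := h.energy_nonpos (norm_zeroState n) (H1_zeroState hθ.le)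
  exact eq_smul_zeroState_of_eigen hθ hE h.1 hv

theorem IsGroundState.eq_smul_plusState {n : ℕ} {θ : ℝ} (hθ : 0 < θ) {v : State n}
    (h : IsGroundState (H0 n θ) v) : ∃ c : ℂ, ‖c‖ = 1 ∧ v = c • plusState n := by
  obtain ⟨E, hE, hv⟩ := h.energy_nonpos (norm_plusState n) (H0_plusState hθ.le)
  exact eq_smul_plusState_of_eigen hθ hE h.1 hv

/-! ### Comparing approximate solutions of the Schrödinger equation -/

/-- The operator -iA is skew-adjoint and drops out of the derivative of ‖ψ - φ‖², so only the
residual moves the distance. Hence there is no Grönwall exponential and no dependence on the size of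
A. -/
theorem norm_sub_le_of_schrodinger {n : ℕ} {A : ℝ → Op n} (hA : ∀ t, (A t).IsHermitian)
    {τ ε : ℝ} (hτ : 0 ≤ τ) {ψ φ ρ : ℝ → State n}
    (hψ : ∀ t ∈ Set.Icc (0 : ℝ) τ,
      HasDerivWithinAt ψ (-Complex.I • (A t).toEuclideanLin (ψ t)) (Set.Icc 0 τ) t)
    (hφ : ∀ t ∈ Set.Icc (0 : ℝ) τ,
      HasDerivWithinAt φ (-Complex.I • (A t).toEuclideanLin (φ t) + ρ t) (Set.Icc 0 τ) t)
    (hρ : ∀ t ∈ Set.Icc (0 : ℝ) τ, ‖ρ t‖ ≤ ε) :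
    ‖ψ τ - φ τ‖ ≤ ‖ψ 0 - φ 0‖ + ε * τ := by
  set δ : ℝ → State n := fun t => ψ t - φ t with hδ
  have hre : ∀ t, (inner ℂ (δ t) (-Complex.I • (A t).toEuclideanLin (δ t))).re = 0 := fun t => by
    have h1 : (inner ℂ (δ t) ((A t).toEuclideanLin (δ t))).im = 0 := by
      rw [← Complex.conj_eq_iff_im, inner_conj_symm, inner_toEuclideanLin (hA t)]
    rw [inner_smul_right]
    simp [h1]
  have hδ' : ∀ t ∈ Set.Icc (0 : ℝ) τ, HasDerivWithinAt δ
      (-Complex.I • (A t).toEuclideanLin (δ t) - ρ t) (Set.Icc 0 τ) t := fun t ht => by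
    refine ((hψ t ht).sub (hφ t ht)).congr_deriv ?_
    simp only [hδ, map_sub, smul_sub]
    abel
  have hN : ∀ t ∈ Set.Icc (0 : ℝ) τ, HasDerivWithinAt (fun t => ‖δ t‖ ^ 2)
      (-2 * (inner ℂ (δ t) (ρ t)).re) (Set.Icc 0 τ) t := fun t ht => by
    have h1 := Complex.reCLM.hasFDerivAt.comp_hasDerivWithinAt t ((hδ' t ht).inner ℂ (hδ' t ht))
    have h2 : (fun t => ‖δ t‖ ^ 2) = Complex.reCLM ∘ fun t => inner ℂ (δ t) (δ t) := by
      ext t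
      simp [inner_self_eq_norm_sq_to_K, ← Complex.ofReal_pow]
    rw [h2]
    refine h1.congr_deriv ?_
    have h3 := hre t
    have h4 : (inner ℂ (-Complex.I • (A t).toEuclideanLin (δ t) - ρ t) (δ t)).re
        = (inner ℂ (δ t) (-Complex.I • (A t).toEuclideanLin (δ t) - ρ t)).re := by
      rw [← inner_conj_symm, Complex.conj_re]
    rw [Complex.reCLM_apply, Complex.add_re, h4, inner_sub_right, Complex.sub_re, h3]
    ring
  -- The norm may fail to be differentiable where δ vanishes. The regularised √(‖δ‖² + η²) is
  -- differentiable with the same bound ε on its slope, and η is arbitrary.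
  refine le_of_forall_pos_le_add fun η hη => ?_
  have hpos : ∀ t, 0 < ‖δ t‖ ^ 2 + η ^ 2 := fun t => by positivity
  have hy : ∀ t ∈ Set.Icc (0 : ℝ) τ, HasDerivWithinAt (fun t => Real.sqrt (‖δ t‖ ^ 2 + η ^ 2))
      (-2 * (inner ℂ (δ t) (ρ t)).re / (2 * Real.sqrt (‖δ t‖ ^ 2 + η ^ 2))) (Set.Icc 0 τ) t :=
    fun t ht => ((hN t ht).add_const _).sqrt (hpos t).ne'
  have hb : ∀ t ∈ Set.Icc (0 : ℝ) τ,
      ‖-2 * (inner ℂ (δ t) (ρ t)).re / (2 * Real.sqrt (‖δ t‖ ^ 2 + η ^ 2))‖ ≤ ε := fun t ht => by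
    have h1 : |(inner ℂ (δ t) (ρ t)).re| ≤ ‖δ t‖ * ‖ρ t‖ :=
      (Complex.abs_re_le_norm _).trans (norm_inner_le_norm _ _)
    have h2 : ‖δ t‖ ≤ Real.sqrt (‖δ t‖ ^ 2 + η ^ 2) :=
      Real.le_sqrt_of_sq_le (by nlinarith)
    have h3 := Real.sqrt_pos.mpr (hpos t)
    rw [norm_div, norm_mul, norm_mul, Real.norm_of_nonneg h3.le, Real.norm_two,
      div_le_iff₀ (by linarith), norm_neg, Real.norm_two, Real.norm_eq_abs]
    nlinarith [mul_le_mul h2 (hρ t ht) (norm_nonneg _) h3.le]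
  have := (convex_Icc (0 : ℝ) τ).norm_image_sub_le_of_norm_hasDerivWithin_le hy hb
    (Set.left_mem_Icc.mpr hτ) (Set.right_mem_Icc.mpr hτ)
  rw [sub_zero, Real.norm_of_nonneg hτ] at this
  have h1 : ‖δ τ‖ ≤ Real.sqrt (‖δ τ‖ ^ 2 + η ^ 2) := Real.le_sqrt_of_sq_le (by nlinarith)
  have h2 : Real.sqrt (‖δ 0‖ ^ 2 + η ^ 2) ≤ ‖δ 0‖ + η :=
    Real.sqrt_le_iff.mpr ⟨by positivity, by nlinarith [norm_nonneg (δ 0)]⟩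
  have h3 := (le_abs_self _).trans this
  change ‖δ τ‖ ≤ ‖δ 0‖ + ε * τ + η
  linarith

/-! ### Exponential tail bounds for the Hamming weight -/

theorem exp_weight {n : ℕ} (l : ℝ) (k : Bits n) :
    Real.exp (l * weight k) = ∏ i, if k i = 1 then Real.exp l else 1 := by
  rw [Finset.prod_ite, Finset.prod_const, Finset.prod_const_one, mul_one, mul_comm,
    Real.exp_nat_mul]
  rfl

theorem sum_exp_weight {n : ℕ} (l : ℝ) (v : Fin n → Fin 2 → ℂ) :
    ∑ k, Real.exp (l * weight k) * ‖tens v k‖ ^ 2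
      = ∏ i, (‖v i 0‖ ^ 2 + Real.exp l * ‖v i 1‖ ^ 2) := by
  have := sum_prod_bits fun i b => (if b = 1 then Real.exp l else 1) * ‖v i b‖ ^ 2
  simp only [zero_ne_one, if_false, if_true, one_mul] at this
  rw [← this]
  refine Finset.sum_congr rfl fun k _ => ?_
  rw [exp_weight, tens_apply, norm_prod, ← Finset.prod_pow, ← Finset.prod_mul_distrib]

/-- Hoeffding's bound for a fair bit: factor out e^(l/2) and use cosh x ≤ e^(x²/2). -/
theorem one_add_exp_le (l : ℝ) : (1 + Real.exp l) / 2 ≤ Real.exp (l / 2 + l ^ 2 / 8) := by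
  have h : (1 + Real.exp l) / 2 = Real.exp (l / 2) * Real.cosh (l / 2) := by
    rw [Real.cosh_eq, mul_div_assoc', mul_add, ← Real.exp_add, ← Real.exp_add]
    simp [add_comm]
  rw [h, Real.exp_add]
  gcongr
  exact (Real.cosh_le_exp_half_sq (l / 2)).trans_eq (by congr 1; ring)

/-- Lower-tail Chernoff bound. Only strings of weight below θ contribute, each with squared factor
at most θ² ≤ θ² e^(l(θ - h)), and the bits of the uniform superposition are independent fair coins.
-/
theorem norm_H1_sub_le {n : ℕ} (hn : 0 < n) {θ D : ℝ} (hθ : 0 < θ) (hD : 0 ≤ D)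
    (h : θ ≤ n / 2 - D) :
    ‖(H1 n θ).toEuclideanLin (plusState n) - (θ : ℂ) • plusState n‖
      ≤ θ * Real.exp (-(D ^ 2 / n)) := by
  have hn' : (0 : ℝ) < n := by exact_mod_cast hn
  -- The minimiser of n l²/8 - l D. The minimum -2D²/n bounds the squared norm, whence D²/n for the
  -- norm.
  set l : ℝ := 4 * D / n with hl
  have hl0 : 0 ≤ l := by positivity
  have hsq : ‖(H1 n θ).toEuclideanLin (plusState n) - (θ : ℂ) • plusState n‖ ^ 2
      ≤ (θ * Real.exp (-(D ^ 2 / n))) ^ 2 := by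
    have h1 : ∀ k : Bits n,
        ‖((H1 n θ).toEuclideanLin (plusState n) - (θ : ℂ) • plusState n) k‖ ^ 2
        ≤ θ ^ 2 * Real.exp (l * θ) * (Real.exp (-l * weight k) * ‖plusState n k‖ ^ 2) :=
        fun k => by
      rw [PiLp.sub_apply, PiLp.smul_apply, H1_apply, smul_eq_mul, ← sub_mul, ← Complex.ofReal_sub,
        norm_mul, mul_pow, Complex.norm_real, Real.norm_eq_abs, sq_abs, ← mul_assoc, mul_assoc (θ ^ 2),
        ← Real.exp_add]
      gcongr
      have hw : (0 : ℝ) ≤ weight k := by positivity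
      rcases le_total θ (weight k) with hk | hk
      · rw [truncWeight, min_eq_left hk, sub_self, zero_pow two_ne_zero]
        positivity
      · rw [truncWeight, min_eq_right hk]
        have h2 : 1 ≤ Real.exp (l * θ + -l * weight k) := Real.one_le_exp (by nlinarith)
        nlinarith
    rw [EuclideanSpace.norm_sq_eq]
    refine (Finset.sum_le_sum fun k _ => h1 k).trans ?_
    rw [← Finset.mul_sum, plusState_eq_tens, sum_exp_weight]
    have h3 : ‖((1 / Real.sqrt 2 : ℝ) : ℂ)‖ ^ 2 = 1 / 2 := by
      rw [Complex.norm_real, Real.norm_eq_abs, sq_abs, div_pow, Real.sq_sqrt (by norm_num)]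
      norm_num
    simp only [Matrix.cons_val_zero, Matrix.cons_val_one, h3, Finset.prod_const, Finset.card_univ,
      Fintype.card_fin]
    have h4 : (1 / 2 + Real.exp (-l) * (1 / 2)) ^ n ≤ Real.exp (n * (-l / 2 + l ^ 2 / 8)) := by
      rw [Real.exp_nat_mul]
      gcongr
      have := one_add_exp_le (-l)
      rw [neg_sq] at this
      linarith
    calc θ ^ 2 * Real.exp (l * θ) * (1 / 2 + Real.exp (-l) * (1 / 2)) ^ n
        ≤ θ ^ 2 * Real.exp (l * (n / 2 - D)) * Real.exp (n * (-l / 2 + l ^ 2 / 8)) := by gcongr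
      _ = (θ * Real.exp (-(D ^ 2 / n))) ^ 2 := by
        rw [mul_pow, mul_assoc, ← Real.exp_add, ← Real.exp_nat_mul]
        congr 2
        rw [hl]
        push_cast
        field_simp
        ring
  exact (sq_le_sq₀ (norm_nonneg _) (by positivity)).mp hsq

/-- Upper-tail counterpart, with threshold n standing for no truncation. The slack `q` admits qubits
that are slightly unnormalised and slightly biased towards 1, as the corrected ansatz is. -/
theorem norm_H1_trunc_sub_le {n : ℕ} (hn : 0 < n) {θ D q : ℝ} (hD : 0 ≤ D)
    (h : n / 2 + D ≤ θ) (hq : 0 ≤ q) {v : Fin n → Fin 2 → ℂ}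
    (hv : ∀ i, ‖v i 0‖ ^ 2 + ‖v i 1‖ ^ 2 ≤ 1 + q) (hv1 : ∀ i, ‖v i 1‖ ^ 2 ≤ 1 / 2 + q) :
    ‖(H1 n θ).toEuclideanLin (tens v) - (H1 n n).toEuclideanLin (tens v)‖
      ≤ n * Real.exp (-(D ^ 2 / n) + n * q) := by
  have hn' : (0 : ℝ) < n := by exact_mod_cast hn
  set l : ℝ := 4 * D / n with hl
  have hl0 : 0 ≤ l := by positivity
  have hsq : ‖(H1 n θ).toEuclideanLin (tens v) - (H1 n n).toEuclideanLin (tens v)‖ ^ 2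
      ≤ (n * Real.exp (-(D ^ 2 / n) + n * q)) ^ 2 := by
    have h1 : ∀ k : Bits n,
        ‖((H1 n θ).toEuclideanLin (tens v) - (H1 n n).toEuclideanLin (tens v)) k‖ ^ 2
        ≤ n ^ 2 * Real.exp (-l * θ) * (Real.exp (l * weight k) * ‖tens v k‖ ^ 2) :=
        fun k => by
      rw [PiLp.sub_apply, H1_apply, H1_apply, ← sub_mul, ← Complex.ofReal_sub,
        norm_mul, mul_pow, Complex.norm_real, Real.norm_eq_abs, sq_abs, ← mul_assoc,
        mul_assoc ((n : ℝ) ^ 2), ← Real.exp_add]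
      gcongr
      have hw : (0 : ℝ) ≤ weight k := by positivity
      have hwn : (weight k : ℝ) ≤ n := by exact_mod_cast weight_le k
      rw [truncWeight, truncWeight, min_eq_right hwn]
      rcases le_total θ (weight k) with hk | hk
      · rw [min_eq_left hk]
        have h2 : 1 ≤ Real.exp (-l * θ + l * weight k) := Real.one_le_exp (by nlinarith)
        have h3 : (θ - weight k) ^ 2 ≤ (n : ℝ) ^ 2 := by
          rw [← neg_sub, neg_sq]
          have : 0 ≤ θ := by linarith
          gcongr
          linarith
        nlinarith
      · rw [min_eq_right hk, sub_self, zero_pow two_ne_zero]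
        positivity
    rw [EuclideanSpace.norm_sq_eq]
    refine (Finset.sum_le_sum fun k _ => h1 k).trans ?_
    rw [← Finset.mul_sum, sum_exp_weight]
    have h5 : 1 ≤ Real.exp l := Real.one_le_exp hl0
    have h4 : ∏ i, (‖v i 0‖ ^ 2 + Real.exp l * ‖v i 1‖ ^ 2)
        ≤ Real.exp (n * (l / 2 + l ^ 2 / 8 + 2 * q)) := by
      have h6 : ∏ i, (‖v i 0‖ ^ 2 + Real.exp l * ‖v i 1‖ ^ 2)
          ≤ ∏ _i : Fin n, Real.exp (l / 2 + l ^ 2 / 8 + 2 * q) := by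
        refine Finset.prod_le_prod (fun i _ => by positivity) fun i _ => ?_
        -- Write the left side as the total mass plus (e^l - 1) times the mass at 1 and bound each
        -- separately; `l ≥ 0` makes the coefficient nonnegative.
        have h7 : ‖v i 0‖ ^ 2 + Real.exp l * ‖v i 1‖ ^ 2 ≤ (1 + Real.exp l) / 2 * (1 + 2 * q) := by
          nlinarith [hv i, mul_le_mul_of_nonneg_left (hv1 i) (sub_nonneg.mpr h5)]
        refine h7.trans ?_
        rw [Real.exp_add]
        gcongr
        · exact one_add_exp_le l
        · linarith [Real.add_one_le_exp (2 * q)]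
      rwa [Finset.prod_const, Finset.card_univ, Fintype.card_fin, ← Real.exp_nat_mul] at h6
    calc (n : ℝ) ^ 2 * Real.exp (-l * θ) * ∏ i, (‖v i 0‖ ^ 2 + Real.exp l * ‖v i 1‖ ^ 2)
        ≤ (n : ℝ) ^ 2 * Real.exp (-l * (n / 2 + D))
            * Real.exp (n * (l / 2 + l ^ 2 / 8 + 2 * q)) := by
          gcongr ?_ * Real.exp ?_ * ?_
          nlinarith
      _ = (n * Real.exp (-(D ^ 2 / n) + n * q)) ^ 2 := by
        rw [mul_pow, mul_assoc, ← Real.exp_add, ← Real.exp_nat_mul]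
        congr 2
        rw [hl]
        push_cast
        field_simp
        ring
  exact (sq_le_sq₀ (norm_nonneg _) (by positivity)).mp hsq

/-! ### The uniform superposition is an approximate eigenvector -/

theorem norm_H_plusState_sub_le {n : ℕ} (hn : 0 < n) {θ D s : ℝ} (hθ : 0 < θ) (hD : 0 ≤ D)
    (h : θ ≤ n / 2 - D) (hs : s ∈ Set.Icc (0 : ℝ) 1) :
    ‖(H n θ s).toEuclideanLin (plusState n) - ((s * θ : ℝ) : ℂ) • plusState n‖
      ≤ θ * Real.exp (-(D ^ 2 / n)) := by
  have h1 : (H n θ s).toEuclideanLin (plusState n) - ((s * θ : ℝ) : ℂ) • plusState n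
      = ((s : ℝ) : ℂ) • ((H1 n θ).toEuclideanLin (plusState n) - (θ : ℂ) • plusState n) := by
    rw [H_apply, H0_plusState hθ.le, smul_zero, zero_add, smul_sub, smul_smul, Complex.ofReal_mul]
  rw [h1, norm_smul, Complex.norm_real, Real.norm_of_nonneg hs.1]
  exact (mul_le_of_le_one_left (norm_nonneg _) hs.2).trans (norm_H1_sub_le hn hθ hD h)

theorem IsAdiabaticEvolution.norm_sub_le {n : ℕ} {θ τ ε : ℝ} {ψ : ℝ → State n}
    (h : IsAdiabaticEvolution n θ τ ψ) (hθ : 0 < θ) (hτ : 0 < τ)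
    (hε : ∀ s ∈ Set.Icc (0 : ℝ) 1,
      ‖(H n θ s).toEuclideanLin (plusState n) - ((s * θ : ℝ) : ℂ) • plusState n‖ ≤ ε) :
    ∃ c : ℂ, ‖c‖ = 1 ∧ ‖ψ τ - c • plusState n‖ ≤ ε * τ := by
  obtain ⟨c, hc, hψ0⟩ := h.initial.eq_smul_plusState hθ
  -- The dynamical phase: θt²/(2τ) is the integral of the approximate energy θt/τ.
  set e : ℝ → ℂ := fun t => Complex.exp (((-(θ * t ^ 2 / (2 * τ)) : ℝ) : ℂ) * Complex.I) * c with he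
  have hnorm : ∀ t, ‖e t‖ = 1 := fun t => by
    rw [he, norm_mul, Complex.norm_exp_ofReal_mul_I, hc, one_mul]
  have hde : ∀ t, HasDerivAt e (-Complex.I * ((t / τ * θ : ℝ) : ℂ) * e t) t := fun t => by
    have h1 : HasDerivAt (fun t : ℝ => -(θ * t ^ 2 / (2 * τ))) (-(t / τ * θ)) t := by
      refine (((hasDerivAt_pow 2 t).const_mul θ).div_const (2 * τ)).neg.congr_deriv ?_
      field_simp
      norm_num
    refine ((h1.ofReal_comp.mul_const Complex.I).cexp.mul_const c).congr_deriv ?_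
    simp only [he]
    push_cast
    ring
  refine ⟨e τ, hnorm τ, ?_⟩
  have key := norm_sub_le_of_schrodinger (fun t => isHermitian_H n θ (t / τ)) hτ.le
    (φ := fun t => e t • plusState n)
    (ρ := fun t => (Complex.I * e t) • ((H n θ (t / τ)).toEuclideanLin (plusState n)
      - ((t / τ * θ : ℝ) : ℂ) • plusState n)) (ε := ε) h.schrodinger
    (fun t _ => by
      refine ((hde t).smul_const (plusState n)).hasDerivWithinAt.congr_deriv ?_
      rw [map_smul, smul_sub, smul_smul, smul_smul]
      module)
    (fun t ht => by
      rw [norm_smul, norm_mul, Complex.norm_I, hnorm, one_mul, one_mul]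
      exact hε _ ⟨div_nonneg ht.1 hτ.le, (div_le_one hτ).mpr ht.2⟩)
  have h0 : ψ 0 - e 0 • plusState n = 0 := by
    rw [hψ0]
    simp [he]
  simpa [h0] using key

theorem IsAdiabaticEvolution.overlap_le {n : ℕ} {θ τ ε : ℝ} {ψ : ℝ → State n} {α : State n}
    (h : IsAdiabaticEvolution n θ τ ψ) (hα : IsGroundState (H1 n θ) α) (hθ : 0 < θ) (hτ : 0 < τ)
    (hε : ∀ s ∈ Set.Icc (0 : ℝ) 1,
      ‖(H n θ s).toEuclideanLin (plusState n) - ((s * θ : ℝ) : ℂ) • plusState n‖ ≤ ε) :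
    ‖inner ℂ α (ψ τ)‖ ≤ Real.sqrt ((1 / 2) ^ n) + ε * τ := by
  obtain ⟨c, hc, hle⟩ := h.norm_sub_le hθ hτ hε
  obtain ⟨a, ha, rfl⟩ := hα.eq_smul_zeroState hθ
  have h1 : ψ τ = c • plusState n + (ψ τ - c • plusState n) := by abel
  have h2 : ‖inner ℂ (zeroState n) (plusState n)‖ = Real.sqrt ((1 / 2) ^ n) := by
    rw [← norm_sq_inner_zeroState_plusState, Real.sqrt_sq (norm_nonneg _)]
  have h3 := norm_inner_le_norm (𝕜 := ℂ) (zeroState n) (ψ τ - c • plusState n)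
  rw [norm_zeroState, one_mul] at h3
  rw [inner_smul_left, norm_mul, RCLike.norm_conj, ha, one_mul, h1, inner_add_right,
    inner_smul_right]
  refine (norm_add_le _ _).trans ?_
  rw [norm_mul, hc, one_mul, h2]
  linarith

/-! ### Ground states and the spectral gap -/

theorem two_le_card_bits {n : ℕ} (hn : 0 < n) : 2 ≤ Fintype.card (Bits n) := by
  simp only [Fintype.card_fun, Fintype.card_fin]
  exact Nat.le_self_pow hn.ne' 2

theorem gap_nonneg {ι : Type*} [Fintype ι] [DecidableEq ι] {A : Matrix ι ι ℂ}
    (hA : A.IsHermitian) : 0 ≤ gap hA := by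
  unfold gap
  split_ifs with h
  · exact sub_nonneg.mpr (hA.eigenvalues₀_antitone (by simp only [Fin.mk_le_mk]; omega))
  · exact le_rfl

theorem minGap_nonneg (n : ℕ) (θ : ℝ) : 0 ≤ minGap n θ :=
  Real.iInf_nonneg fun _ => gap_nonneg _

theorem minGap_le_gap {n : ℕ} (θ : ℝ) {s : ℝ} (hs : s ∈ Set.Icc (0 : ℝ) 1) :
    minGap n θ ≤ gap (isHermitian_H n θ s) :=
  ciInf_le (f := fun s : Set.Icc (0 : ℝ) 1 => gap (isHermitian_H n θ s))
    ⟨0, Set.forall_mem_range.mpr fun _ => gap_nonneg _⟩ ⟨s, hs⟩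

theorem re_inner_eq_sum_eigenvalues {n : ℕ} {A : Op n} (hA : A.IsHermitian) (x : State n) :
    (inner ℂ x (A.toEuclideanLin x)).re
      = ∑ i, hA.eigenvalues i * ‖inner ℂ (hA.eigenvectorBasis i) x‖ ^ 2 := by
  rw [← hA.eigenvectorBasis.sum_inner_mul_inner, Complex.re_sum]
  refine Finset.sum_congr rfl fun i _ => ?_
  have h : A.toEuclideanLin (hA.eigenvectorBasis i)
      = (hA.eigenvalues i : ℂ) • hA.eigenvectorBasis i := by
    rw [Matrix.toLpLin_apply, hA.mulVec_eigenvectorBasis]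
    rfl
  rw [← inner_toEuclideanLin hA, h, inner_smul_left, Complex.conj_ofReal, mul_left_comm,
    ← inner_conj_symm, mul_comm (starRingEnd ℂ _), Complex.mul_conj, ← Complex.ofReal_mul,
    Complex.ofReal_re, Complex.normSq_eq_norm_sq]

/-- Turns the gap, defined through a sorted list of eigenvalues, into Rayleigh quotient bounds by
expanding in an eigenbasis. If the lowest eigenvalue is degenerate the gap is 0 and the last bound
remains valid. -/
theorem exists_ground {n : ℕ} (hn : 0 < n) {A : Op n} (hA : A.IsHermitian) :
    ∃ (u : State n) (E : ℝ), ‖u‖ = 1 ∧ A.toEuclideanLin u = (E : ℂ) • u ∧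
      (∀ x, E * ‖x‖ ^ 2 ≤ (inner ℂ x (A.toEuclideanLin x)).re) ∧
      ∀ x, inner ℂ u x = 0 → (E + gap hA) * ‖x‖ ^ 2 ≤ (inner ℂ x (A.toEuclideanLin x)).re := by
  have hcard := two_le_card_bits hn
  -- This must be the reindexing by which `eigenvalues` is defined from `eigenvalues₀`, so that
  -- `hval` holds by `rfl`.
  set e : Fin (Fintype.card (Bits n)) ≃ Bits n := Fintype.equivOfCardEq (Fintype.card_fin _) with he
  set i₀ : Bits n := e ⟨Fintype.card (Bits n) - 1, by omega⟩ with hi₀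
  have hval : ∀ i, hA.eigenvalues i = hA.eigenvalues₀ (e.symm i) := fun i => rfl
  have hE : hA.eigenvalues i₀ = hA.eigenvalues₀ ⟨Fintype.card (Bits n) - 1, by omega⟩ := by
    rw [hval, hi₀, Equiv.symm_apply_apply]
  have hle : ∀ i, hA.eigenvalues i₀ ≤ hA.eigenvalues i := fun i => by
    rw [hE, hval]
    exact hA.eigenvalues₀_antitone (Fin.mk_le_mk.mpr (by have := (e.symm i).isLt; omega))
  have hgap : ∀ i, i ≠ i₀ → hA.eigenvalues i₀ + gap hA ≤ hA.eigenvalues i := fun i hi => by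
    rw [hE, hval, gap, dif_pos hcard, add_sub_cancel]
    refine hA.eigenvalues₀_antitone (Fin.le_def.mpr ?_)
    have h1 := (e.symm i).isLt
    have h2 : (e.symm i : ℕ) ≠ Fintype.card (Bits n) - 1 := fun h => hi (by
      rw [hi₀, ← Equiv.symm_apply_eq]
      exact Fin.ext h)
    change (e.symm i : ℕ) ≤ Fintype.card (Bits n) - 2
    omega
  refine ⟨hA.eigenvectorBasis i₀, hA.eigenvalues i₀, hA.eigenvectorBasis.orthonormal.1 i₀, ?_,
    fun x => ?_, fun x hx => ?_⟩
  · rw [Matrix.toLpLin_apply, hA.mulVec_eigenvectorBasis]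
    rfl
  · rw [re_inner_eq_sum_eigenvalues hA, ← hA.eigenvectorBasis.sum_sq_norm_inner_right,
      Finset.mul_sum]
    exact Finset.sum_le_sum fun i _ => mul_le_mul_of_nonneg_right (hle i) (by positivity)
  · rw [re_inner_eq_sum_eigenvalues hA, ← hA.eigenvectorBasis.sum_sq_norm_inner_right,
      Finset.mul_sum]
    refine Finset.sum_le_sum fun i _ => ?_
    by_cases hi : i = i₀
    · rw [hi, hx]; simp
    · exact mul_le_mul_of_nonneg_right (hgap i hi) (by positivity)

/-- The splitting of `x` along a unit eigenvector `u` and its orthogonal complement. -/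
theorem exists_orthogonal_decomposition {n : ℕ} {A : Op n} (hA : A.IsHermitian) {u : State n}
    {E : ℝ} (hu : ‖u‖ = 1) (hAu : A.toEuclideanLin u = (E : ℂ) • u) (x : State n) :
    ∃ w : State n, x = inner ℂ u x • u + w ∧ inner ℂ u w = 0 ∧
      ‖x‖ ^ 2 = ‖inner ℂ u x‖ ^ 2 + ‖w‖ ^ 2 ∧ inner ℂ w x = ((‖w‖ ^ 2 : ℝ) : ℂ) ∧
      inner ℂ w (A.toEuclideanLin x) = inner ℂ w (A.toEuclideanLin w) ∧
      (inner ℂ x (A.toEuclideanLin x)).re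
        = E * ‖inner ℂ u x‖ ^ 2 + (inner ℂ w (A.toEuclideanLin w)).re := by
  have huu : inner ℂ u u = 1 := by rw [inner_self_eq_norm_sq_to_K, hu]; simp
  set a : ℂ := inner ℂ u x with ha
  set w : State n := x - a • u with hw
  have hx : x = a • u + w := by rw [hw]; abel
  have huw : inner ℂ u w = 0 := by
    rw [hw, inner_sub_right, inner_smul_right, huu, mul_one, ← ha, sub_self]
  have hwu : inner ℂ w u = 0 := by rw [← inner_conj_symm, huw, map_zero]
  have hwx : inner ℂ w x = ((‖w‖ ^ 2 : ℝ) : ℂ) := by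
    conv_lhs => rw [hx]
    rw [inner_add_right, inner_smul_right, hwu, mul_zero, zero_add, inner_self_eq_norm_sq_to_K]
    simp
  have hwA : inner ℂ w (A.toEuclideanLin x) = inner ℂ w (A.toEuclideanLin w) := by
    conv_lhs => rw [hx]
    rw [map_add, map_smul, hAu, inner_add_right, inner_smul_right, inner_smul_right, hwu]
    simp
  refine ⟨w, hx, huw, ?_, hwx, hwA, ?_⟩
  · have h1 : ((‖x‖ ^ 2 : ℝ) : ℂ) = ((‖a‖ ^ 2 + ‖w‖ ^ 2 : ℝ) : ℂ) := by
      have : inner ℂ x x = ((‖x‖ ^ 2 : ℝ) : ℂ) := by rw [inner_self_eq_norm_sq_to_K]; simp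
      rw [← this]
      conv_lhs => enter [2]; rw [hx]
      rw [inner_add_left, inner_smul_left, ← ha, hwx, Complex.ofReal_add, ← Complex.normSq_eq_norm_sq,
        ← Complex.mul_conj, mul_comm]
    exact_mod_cast h1
  · have h1 : inner ℂ x (A.toEuclideanLin x)
        = ((E * ‖a‖ ^ 2 : ℝ) : ℂ) + inner ℂ w (A.toEuclideanLin w) := by
      rw [← hwA]
      conv_lhs => enter [2]; rw [hx]
      rw [inner_add_left, inner_smul_left, ← inner_toEuclideanLin hA u x, hAu, inner_smul_left,
        ← ha, Complex.conj_ofReal, Complex.ofReal_mul, ← Complex.normSq_eq_norm_sq,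
        ← Complex.mul_conj]
      ring
    rw [h1, Complex.add_re, Complex.ofReal_re]

theorem H_apply_sub {n : ℕ} (θ s t : ℝ) (x : State n) :
    (H n θ s).toEuclideanLin x = (H n θ t).toEuclideanLin x
      + ((s - t : ℝ) : ℂ) • (H1 n θ - H0 n θ).toEuclideanLin x := by
  rw [H_apply, H_apply, map_sub, LinearMap.sub_apply]
  push_cast
  module

theorem re_inner_H_le {n : ℕ} (θ : ℝ) : ∃ M : ℝ, 0 ≤ M ∧ ∀ (s t : ℝ) (x : State n), ‖x‖ = 1 →
    (inner ℂ x ((H n θ s).toEuclideanLin x)).re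
      ≤ (inner ℂ x ((H n θ t).toEuclideanLin x)).re + M * |s - t| := by
  set B := LinearMap.toContinuousLinearMap (H1 n θ - H0 n θ).toEuclideanLin with hB
  refine ⟨‖B‖, norm_nonneg _, fun s t x hx => ?_⟩
  have h1 : ‖inner ℂ x ((H1 n θ - H0 n θ).toEuclideanLin x)‖ ≤ ‖B‖ := by
    refine (norm_inner_le_norm _ _).trans ?_
    have := B.le_opNorm x
    rw [hx, mul_one] at this
    rw [hx, one_mul]
    exact this
  rw [H_apply_sub θ s t x, inner_add_right, Complex.add_re, inner_smul_right]
  gcongr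
  refine (Complex.re_le_norm _).trans ?_
  rw [norm_mul, Complex.norm_real, Real.norm_eq_abs, mul_comm]
  gcongr

theorem minGap_le {n : ℕ} (hn : 0 < n) {θ ε : ℝ} (hθ : 0 < θ)
    (hε : ∀ s ∈ Set.Icc (0 : ℝ) 1,
      ‖(H n θ s).toEuclideanLin (plusState n) - ((s * θ : ℝ) : ℂ) • plusState n‖ ≤ ε) :
    minGap n θ ≤ 4 * ε := by
  have hε0 : 0 ≤ ε := (norm_nonneg _).trans (hε 0 (by simp))
  by_contra! hlt
  set g := minGap n θ with hg
  have hg0 : 0 < g := by linarith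
  -- The phases of the chosen ground states are arbitrary. Only the moduli `P` of overlaps are used,
  -- so no continuous choice of `u` is needed.
  choose u E hu hE hmin hgap' using fun s => exists_ground hn (isHermitian_H n θ s)
  have hgap : ∀ s ∈ Set.Icc (0 : ℝ) 1, ∀ x, inner ℂ (u s) x = 0 →
      (E s + g) * ‖x‖ ^ 2 ≤ (inner ℂ x ((H n θ s).toEuclideanLin x)).re := fun s hs x hx =>
    (mul_le_mul_of_nonneg_right (by linarith [minGap_le_gap (n := n) θ hs]) (by positivity)).trans
      (hgap' s x hx)
  have hEu : ∀ s, (inner ℂ (u s) ((H n θ s).toEuclideanLin (u s))).re = E s := fun s => by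
    rw [hE, inner_smul_right, inner_self_eq_norm_sq_to_K, hu]
    simp
  obtain ⟨M, hM0, hM⟩ := re_inner_H_le (n := n) θ
  set P : ℝ → ℝ := fun s => ‖inner ℂ (u s) (plusState n)‖ with hP
  -- Let w be the part of `u t` orthogonal to `u s`. The gap at s makes it cost at least g‖w‖² in
  -- energy, while `u t` has energy within 2M|t - s| of `E s`: one M for changing the Hamiltonian,
  -- one for comparing `E t` with `E s`.
  have hstep : ∀ s ∈ Set.Icc (0 : ℝ) 1, ∀ t, P t - P s ≤ Real.sqrt (2 * M / g * |t - s|) :=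
      fun s hs t => by
    obtain ⟨w, hw, huw, hnorm, -, -, hre⟩ :=
      exists_orthogonal_decomposition (isHermitian_H n θ s) (hu s) (hE s) (u t)
    set a := inner ℂ (u s) (u t)
    rw [hu, one_pow] at hnorm
    have h1 := hgap s hs w huw
    have h2 := hM s t (u t) (hu t)
    have h3 := hM t s (u s) (hu s)
    have h4 := hmin t (u s)
    rw [hEu] at h2 h3
    rw [hu, one_pow, mul_one] at h4
    rw [abs_sub_comm s t] at h2
    have h5 : ‖w‖ ^ 2 ≤ 2 * M / g * |t - s| := by
      rw [div_mul_eq_mul_div, le_div_iff₀ hg0]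
      have : ‖a‖ ^ 2 = 1 - ‖w‖ ^ 2 := by linarith
      rw [this] at hre
      linarith
    have h6 : P t ≤ P s + ‖w‖ := by
      simp only [hP]
      rw [hw, inner_add_left, inner_smul_left]
      refine (norm_add_le _ _).trans ?_
      rw [norm_mul, RCLike.norm_conj]
      have h7 : ‖a‖ ≤ 1 := by nlinarith [norm_nonneg a, sq_nonneg ‖w‖]
      have h8 := norm_inner_le_norm (𝕜 := ℂ) w (plusState n)
      rw [norm_plusState, mul_one] at h8
      have := mul_le_of_le_one_left (norm_nonneg (inner ℂ (u s) (plusState n))) h7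
      linarith
    have := Real.le_sqrt_of_sq_le h5
    linarith
  have hcont : ContinuousOn (fun s => P s ^ 2) (Set.Icc 0 1) := by
    refine ContinuousOn.pow (fun s hs => ?_) 2
    rw [ContinuousWithinAt, tendsto_iff_dist_tendsto_zero]
    refine squeeze_zero' (g := fun t => Real.sqrt (2 * M / g * |t - s|))
      (Eventually.of_forall fun _ => dist_nonneg) ?_ ?_
    · filter_upwards [self_mem_nhdsWithin] with t ht
      rw [Real.dist_eq, abs_le]
      refine ⟨?_, hstep s hs t⟩
      have := hstep t ht s
      rw [abs_sub_comm s t] at this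
      linarith
    · have : Continuous fun t : ℝ => Real.sqrt (2 * M / g * |t - s|) := by fun_prop
      have h := (this.tendsto s).mono_left (nhdsWithin_le_nhds (s := Set.Icc (0 : ℝ) 1))
      simpa using h
  have hP0 : P 0 ^ 2 = 1 := by
    have hH : H n θ 0 = H0 n θ := by simp [H]
    have h1 := hmin 0 (plusState n)
    rw [hH, H0_plusState hθ.le, norm_plusState, inner_zero_right] at h1
    obtain ⟨c, hc, h2⟩ := eq_smul_plusState_of_eigen hθ (by simpa using h1) (hu 0)
      (by rw [← hH]; exact hE 0)
    simp only [hP]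
    rw [h2, inner_smul_left, norm_mul, RCLike.norm_conj, hc, inner_self_eq_norm_sq_to_K,
      norm_plusState]
    simp
  have hP1 : P 1 ^ 2 ≤ 1 / 2 := by
    have hH : H n θ 1 = H1 n θ := by simp [H]
    have h1 := hmin 1 (zeroState n)
    rw [hH, H1_zeroState hθ.le, norm_zeroState, inner_zero_right] at h1
    obtain ⟨c, hc, h2⟩ := eq_smul_zeroState_of_eigen hθ (by simpa using h1) (hu 1)
      (by rw [← hH]; exact hE 1)
    simp only [hP]
    rw [h2, inner_smul_left, norm_mul, RCLike.norm_conj, hc, one_mul,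
      norm_sq_inner_zeroState_plusState]
    exact pow_le_of_le_one (by norm_num) (by norm_num) hn.ne'
  -- At this crossing, testing the approximate eigenvalue equation against `w` gives E + g ≤ sθ +
  -- 2ε, and testing it against `u s` gives sθ - E ≤ 2ε. Together they yield g ≤ 4ε, a
  -- contradiction.
  obtain ⟨s, hs, hPs⟩ := intermediate_value_Icc' zero_le_one hcont
    (show (1 / 2 : ℝ) ∈ _ from ⟨hP1, by rw [hP0]; norm_num⟩)
  obtain ⟨w, hw, huw, hnorm, hwx, hwA, -⟩ :=
    exists_orthogonal_decomposition (isHermitian_H n θ s) (hu s) (hE s) (plusState n)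
  have hPs' : ‖inner ℂ (u s) (plusState n)‖ ^ 2 = 1 / 2 := hPs
  rw [norm_plusState, hPs'] at hnorm
  have hw2 : ‖w‖ ^ 2 = 1 / 2 := by linarith
  have h1 := hgap s hs w huw
  have hr := hε s hs
  set r := (H n θ s).toEuclideanLin (plusState n) - ((s * θ : ℝ) : ℂ) • plusState n with hrdef
  have h2 : (inner ℂ w ((H n θ s).toEuclideanLin w)).re ≤ s * θ / 2 + ε := by
    have h3 : inner ℂ w r
        = inner ℂ w ((H n θ s).toEuclideanLin w) - ((s * θ * ‖w‖ ^ 2 : ℝ) : ℂ) := by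
      rw [hrdef, inner_sub_right, hwA, inner_smul_right, hwx, Complex.ofReal_mul (s * θ)]
    have h4 : (inner ℂ w r).re ≤ ε := by
      refine (Complex.re_le_norm _).trans ((norm_inner_le_norm _ _).trans ?_)
      have : ‖w‖ ≤ 1 := by nlinarith [norm_nonneg w]
      nlinarith [norm_nonneg r]
    rw [h3, Complex.sub_re, Complex.ofReal_re, hw2] at h4
    linarith
  have h5 : s * θ - E s ≤ 2 * ε := by
    have h6 : inner ℂ (u s) r = ((E s - s * θ : ℝ) : ℂ) * inner ℂ (u s) (plusState n) := by
      rw [hrdef, inner_sub_right, ← inner_toEuclideanLin (isHermitian_H n θ s), hE,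
        inner_smul_left, inner_smul_right, Complex.conj_ofReal]
      push_cast
      ring
    have h7 := norm_inner_le_norm (𝕜 := ℂ) (u s) r
    rw [h6, hu, one_mul, norm_mul, Complex.norm_real, Real.norm_eq_abs, abs_sub_comm] at h7
    have h8 : 1 / 2 ≤ ‖inner ℂ (u s) (plusState n)‖ := by
      nlinarith [norm_nonneg (inner ℂ (u s) (plusState n))]
    nlinarith [le_abs_self (s * θ - E s), abs_nonneg (s * θ - E s)]
  rw [hw2] at h1
  linarith

/-! ### Small thresholds: failure and exponentially small gap -/

/-- Since log^c n = log^(c-1) n · log n and the first factor is unbounded for c > 1, it eventually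
exceeds any fixed degree m. -/
theorem eventually_exp_neg_log_rpow_le {c : ℝ} (hc : 1 < c) (m : ℕ) :
    ∀ᶠ n : ℕ in atTop, Real.exp (-Real.log n ^ c) ≤ ((n : ℝ) ^ m)⁻¹ := by
  have h1 : Tendsto (fun n : ℕ => Real.log (n : ℝ) ^ (c - 1)) atTop atTop :=
    (tendsto_rpow_atTop (sub_pos.mpr hc)).comp
      (Real.tendsto_log_atTop.comp tendsto_natCast_atTop_atTop)
  filter_upwards [h1.eventually_ge_atTop (m : ℝ), eventually_gt_atTop 1] with n hn hn1
  have hn1' : (1 : ℝ) < n := by exact_mod_cast hn1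
  have hlog : 0 < Real.log n := Real.log_pos hn1'
  have h2 : Real.log n ^ c = Real.log n ^ (c - 1) * Real.log n := by
    rw [← Real.rpow_add_one hlog.ne', sub_add_cancel]
  rw [Real.exp_neg]
  gcongr
  calc (n : ℝ) ^ m = Real.exp (m * Real.log n) := by
        rw [Real.exp_nat_mul, Real.exp_log (by linarith)]
    _ ≤ _ := by
        rw [h2]
        gcongr

theorem isNegligible_of_le {f : ℕ → ℝ} {c C : ℝ} (hc : 1 < c) {d : ℕ}
    (h : ∀ᶠ n : ℕ in atTop, |f n| ≤ C * (n : ℝ) ^ d * Real.exp (-Real.log n ^ c)) :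
    IsNegligible f := by
  intro k
  -- One spare power of n turns the O-bound into the required little-o.
  have h1 : f =O[atTop] fun n : ℕ => ((n : ℝ) ^ (k + 1))⁻¹ := by
    refine IsBigO.of_bound |C| ?_
    filter_upwards [h, eventually_exp_neg_log_rpow_le hc (d + (k + 1)), eventually_gt_atTop 0]
      with n hn hexp hn0
    have hn0' : (0 : ℝ) < n := by exact_mod_cast hn0
    rw [Real.norm_eq_abs, Real.norm_of_nonneg (by positivity)]
    calc |f n| ≤ C * (n : ℝ) ^ d * Real.exp (-Real.log n ^ c) := hn
      _ ≤ |C| * (n : ℝ) ^ d * ((n : ℝ) ^ (d + (k + 1)))⁻¹ := by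
          gcongr
          exact le_abs_self C
      _ = |C| * ((n : ℝ) ^ (k + 1))⁻¹ := by
          rw [pow_add _ d]
          field_simp
  refine h1.trans_isLittleO (IsLittleO.inv_rev ?_ ?_)
  · exact (isLittleO_pow_pow_atTop_of_lt (𝕜 := ℝ) (Nat.lt_succ_self k)).comp_tendsto
      tendsto_natCast_atTop_atTop
  · filter_upwards [eventually_gt_atTop 0] with n hn h0
    exact absurd h0 (by positivity)

section SmallThreshold

variable {c : ℝ} {θ : ℕ → ℝ}

theorem eventually_norm_H_plusState_sub_le
    (hθ : ∀ᶠ n : ℕ in atTop,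
      0 < θ n ∧ θ n ≤ (n : ℝ) / 2 - Real.sqrt ((n : ℝ) * Real.log (n : ℝ) ^ c)) :
    ∀ᶠ n : ℕ in atTop, 0 < θ n ∧ θ n ≤ n ∧
      Real.sqrt ((1 / 2) ^ n) ≤ Real.exp (-Real.log n ^ c) ∧
      ∀ s ∈ Set.Icc (0 : ℝ) 1, ‖(H n (θ n) s).toEuclideanLin (plusState n)
        - ((s * θ n : ℝ) : ℂ) • plusState n‖ ≤ θ n * Real.exp (-Real.log n ^ c) := by
  filter_upwards [hθ, eventually_gt_atTop 0] with n ⟨hpos, hle⟩ hn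
  have hn' : (0 : ℝ) < n := by exact_mod_cast hn
  have hlog : 0 ≤ Real.log n ^ c := Real.rpow_nonneg (Real.log_natCast_nonneg n) c
  set D := Real.sqrt ((n : ℝ) * Real.log (n : ℝ) ^ c) with hD
  have hD0 : 0 ≤ D := Real.sqrt_nonneg _
  have hD2 : D ^ 2 = n * Real.log n ^ c := Real.sq_sqrt (by positivity)
  have hD2n : D ^ 2 / n = Real.log n ^ c := by rw [hD2, mul_div_cancel_left₀ _ hn'.ne']
  refine ⟨hpos, by linarith, ?_, fun s hs => ?_⟩
  -- Positivity of θ forces D ≤ n/2, so the hypothesis on θ itself bounds log^c n. With 1/2 ≤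
  -- e^(-1/2) this makes 2^(-n/2) no larger than the Chernoff error.
  · have h1 : Real.log n ^ c ≤ n / 4 := by
      have : D ^ 2 ≤ (n / 2 : ℝ) ^ 2 := by
        gcongr
        linarith
      rw [← hD2n, div_le_iff₀ hn']
      linarith
    have h2 : (1 / 2 : ℝ) ≤ Real.exp (-(1 / 2)) := by
      linarith [Real.add_one_le_exp (-(1 / 2 : ℝ))]
    rw [Real.sqrt_le_iff]
    refine ⟨by positivity, ?_⟩
    calc (1 / 2 : ℝ) ^ n ≤ Real.exp (-(1 / 2)) ^ n := by gcongr
      _ = Real.exp (n * -(1 / 2)) := (Real.exp_nat_mul _ _).symm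
      _ ≤ Real.exp ((2 : ℕ) * -Real.log n ^ c) := by
          refine Real.exp_le_exp.mpr ?_
          push_cast
          linarith
      _ = _ := Real.exp_nat_mul _ _
  · rw [← hD2n]
    exact norm_H_plusState_sub_le hn hpos hD0 hle hs

theorem fails_of_le (hc : 1 < c)
    (hθ : ∀ᶠ n : ℕ in atTop,
      0 < θ n ∧ θ n ≤ (n : ℝ) / 2 - Real.sqrt ((n : ℝ) * Real.log (n : ℝ) ^ c))
    {τ : ℕ → ℝ} (hτ : ∀ᶠ n : ℕ in atTop, 0 < τ n)
    (hτd : ∃ d : ℕ, τ =O[atTop] fun n : ℕ => (n : ℝ) ^ d) : Fails θ τ := by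
  intro ψ α hψ hα
  obtain ⟨d, hd⟩ := hτd
  obtain ⟨C, hC0, hC⟩ := hd.exists_pos
  refine isNegligible_of_le hc (C := 1 + C) (d := d + 1) ?_
  filter_upwards [hψ, hα, hτ, hC.bound, eventually_norm_H_plusState_sub_le hθ, eventually_gt_atTop 0]
    with n hψn hαn hτn hCn ⟨hpos, hle, hsqrt, hε⟩ hn
  have hn1 : (1 : ℝ) ≤ n := by exact_mod_cast hn
  rw [Real.norm_of_nonneg hτn.le, Real.norm_of_nonneg (by positivity)] at hCn
  rw [abs_norm]
  refine (hψn.overlap_le hαn hpos hτn hε).trans ?_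
  have h1 : (1 : ℝ) ≤ (n : ℝ) ^ (d + 1) := one_le_pow₀ hn1
  have h2 : θ n * τ n ≤ n * (C * (n : ℝ) ^ d) := by gcongr
  have h3 : n * (C * (n : ℝ) ^ d) = C * (n : ℝ) ^ (d + 1) := by ring
  have h4 := Real.exp_pos (-Real.log n ^ c)
  nlinarith

theorem isNegligible_minGap (hc : 1 < c)
    (hθ : ∀ᶠ n : ℕ in atTop,
      0 < θ n ∧ θ n ≤ (n : ℝ) / 2 - Real.sqrt ((n : ℝ) * Real.log (n : ℝ) ^ c)) :
    IsNegligible fun n => minGap n (θ n) := by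
  refine isNegligible_of_le hc (C := 4) (d := 1) ?_
  filter_upwards [eventually_norm_H_plusState_sub_le hθ, eventually_gt_atTop 0]
    with n ⟨hpos, hle, _, hε⟩ hn
  rw [abs_of_nonneg (minGap_nonneg _ _)]
  refine (minGap_le hn hpos hε).trans ?_
  rw [pow_one, mul_assoc]
  gcongr

end SmallThreshold

/-! ### The untruncated Hamiltonian on product states -/

theorem tens_update_apply {n : ℕ} (v : Fin n → Fin 2 → ℂ) (i : Fin n) (w : Fin 2 → ℂ)
    (k : Bits n) :
    tens (Function.update v i w) k = w (k i) * ∏ j ∈ Finset.univ.erase i, v j (k j) := by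
  rw [tens_apply, ← Finset.mul_prod_erase _ _ (Finset.mem_univ i), Function.update_self]
  congr 1
  exact Finset.prod_congr rfl fun j hj => by
    rw [Function.update_of_ne (Finset.ne_of_mem_erase hj)]

theorem tens_update_add {n : ℕ} (v : Fin n → Fin 2 → ℂ) (i : Fin n) (w w' : Fin 2 → ℂ) :
    tens (Function.update v i (w + w'))
      = tens (Function.update v i w) + tens (Function.update v i w') := by
  ext k
  rw [PiLp.add_apply, tens_update_apply, tens_update_apply, tens_update_apply, Pi.add_apply, add_mul]

theorem tens_update_smul {n : ℕ} (v : Fin n → Fin 2 → ℂ) (i : Fin n) (c : ℂ) (w : Fin 2 → ℂ) :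
    tens (Function.update v i (c • w)) = c • tens (Function.update v i w) := by
  ext k
  rw [PiLp.smul_apply, tens_update_apply, tens_update_apply, Pi.smul_apply, smul_mul_assoc]

/-- At threshold n nothing is truncated, so the weight is a sum of bits and the operator acts on one
qubit at a time. -/
theorem H1_tens {n : ℕ} (v : Fin n → Fin 2 → ℂ) :
    (H1 n n).toEuclideanLin (tens v) = ∑ i, tens (Function.update v i ![0, v i 1]) := by
  ext k
  have h1 : truncWeight (n : ℝ) k = weight k := min_eq_right (by exact_mod_cast weight_le k)
  have h2 : ((weight k : ℝ) : ℂ) = ∑ i, if k i = 1 then (1 : ℂ) else 0 := by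
    rw [weight, Finset.card_filter]
    simp
  rw [H1_apply, h1, h2, Finset.sum_mul, WithLp.ofLp_sum, Finset.sum_apply]
  refine Finset.sum_congr rfl fun i _ => ?_
  rw [tens_update_apply, tens_apply, ← Finset.mul_prod_erase _ _ (Finset.mem_univ i), ← mul_assoc]
  congr 1
  rcases Fin.exists_fin_two.mp ⟨k i, rfl⟩ with h | h <;> simp [h]

theorem hadamard_mulVec (w : Fin 2 → ℂ) :
    hadamard *ᵥ w = ![((1 / Real.sqrt 2 : ℝ) : ℂ) * (w 0 + w 1),
      ((1 / Real.sqrt 2 : ℝ) : ℂ) * (w 0 - w 1)] := by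
  ext b
  fin_cases b <;> simp [hadamard, Matrix.mulVec, dotProduct, Fin.sum_univ_two] <;> ring

theorem hadamard_hadamard (w : Fin 2 → ℂ) : hadamard *ᵥ (hadamard *ᵥ w) = w := by
  rw [Matrix.mulVec_mulVec, hadamard_mul_self, Matrix.one_mulVec]

theorem one_div_sqrt_two_sq :
    ((1 / Real.sqrt 2 : ℝ) : ℂ) * ((1 / Real.sqrt 2 : ℝ) : ℂ) = 1 / 2 := by
  rw [← Complex.ofReal_mul, div_mul_div_comm, Real.mul_self_sqrt (by norm_num)]
  norm_num

theorem H0_tens {n : ℕ} (v : Fin n → Fin 2 → ℂ) :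
    (H0 n n).toEuclideanLin (tens v)
      = ∑ i, tens (Function.update v i ![(v i 0 - v i 1) / 2, (v i 1 - v i 0) / 2]) := by
  rw [H0_apply, walsh_tens, H1_tens, map_sum]
  refine Finset.sum_congr rfl fun i _ => ?_
  rw [walsh_tens]
  congr 1
  ext j : 1
  by_cases hj : j = i
  · subst hj
    rw [Function.update_self, Function.update_self, hadamard_mulVec, hadamard_mulVec]
    ext b
    have h := one_div_sqrt_two_sq
    fin_cases b
    · simp only [Matrix.cons_val_zero, Matrix.cons_val_one, Fin.zero_eta]
      linear_combination (v j 0 - v j 1) * h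
    · simp only [Matrix.cons_val_zero, Matrix.cons_val_one, Fin.mk_one]
      linear_combination (v j 1 - v j 0) * h
  · rw [Function.update_of_ne hj, Function.update_of_ne hj, hadamard_hadamard]

/-- The untruncated Hamiltonian of a single qubit. -/
def qubitH (s : ℝ) (w : Fin 2 → ℂ) : Fin 2 → ℂ :=
  ((1 - s : ℝ) : ℂ) • ![(w 0 - w 1) / 2, (w 1 - w 0) / 2] + ((s : ℝ) : ℂ) • ![0, w 1]

theorem H_tens {n : ℕ} (s : ℝ) (v : Fin n → Fin 2 → ℂ) :
    (H n n s).toEuclideanLin (tens v) = ∑ i, tens (Function.update v i (qubitH s (v i))) := by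
  rw [H_apply, H0_tens, H1_tens, Finset.smul_sum, Finset.smul_sum, ← Finset.sum_add_distrib]
  refine Finset.sum_congr rfl fun i _ => ?_
  rw [qubitH, tens_update_add, tens_update_smul, tens_update_smul]

theorem hasDerivAt_tens {n : ℕ} {v : ℝ → Fin 2 → ℂ} {v' : Fin 2 → ℂ} {t : ℝ}
    (hv : ∀ b, HasDerivAt (fun t => v t b) (v' b) t) :
    HasDerivAt (fun t => (tens fun _ => v t : State n))
      (∑ i, tens (Function.update (fun _ => v t) i v')) t := by
  have h1 : HasDerivAt (fun t (k : Bits n) => ∏ i, v t (k i))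
      (fun k => ∑ i, (∏ j ∈ Finset.univ.erase i, v t (k j)) • v' (k i)) t :=
    hasDerivAt_pi.mpr fun k => HasDerivAt.fun_finsetProd fun i _ => hv (k i)
  have h2 := (PiLp.continuousLinearEquiv 2 ℝ fun _ : Bits n => ℂ).symm.hasFDerivAt.comp_hasDerivAt
    t h1
  refine h2.congr_deriv ?_
  ext k
  rw [WithLp.ofLp_sum, Finset.sum_apply]
  change ∑ i, (∏ j ∈ Finset.univ.erase i, v t (k j)) • v' (k i) = _
  refine Finset.sum_congr rfl fun i _ => ?_
  rw [tens_update_apply, smul_eq_mul, mul_comm]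

/-- The product rule and the non-interacting Hamiltonian both replace one factor at a time, so by
multilinearity a one-qubit residual `w` yields n product terms. -/
theorem hasDerivAt_tens_of_schrodinger {n : ℕ} {v : ℝ → Fin 2 → ℂ} {w : Fin 2 → ℂ} {s t : ℝ}
    (hv : ∀ b, HasDerivAt (fun t => v t b) (-Complex.I * qubitH s (v t) b + w b) t) :
    HasDerivAt (fun t => (tens fun _ => v t : State n))
      (-Complex.I • (H n n s).toEuclideanLin (tens fun _ => v t)
        + ∑ i, tens (Function.update (fun _ => v t) i w)) t := by
  refine (hasDerivAt_tens (v' := -Complex.I • qubitH s (v t) + w) hv).congr_deriv ?_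
  rw [H_tens, Finset.smul_sum, ← Finset.sum_add_distrib]
  refine Finset.sum_congr rfl fun i _ => ?_
  rw [tens_update_add, tens_update_smul]

theorem one_add_pow_le_exp {q : ℝ} (hq : 0 ≤ q) (n : ℕ) : (1 + q) ^ n ≤ Real.exp (n * q) := by
  rw [Real.exp_nat_mul]
  gcongr
  linarith [Real.add_one_le_exp q]

theorem norm_sum_tens_update_le {n : ℕ} {v w : Fin 2 → ℂ} {q r : ℝ} (hq : 0 ≤ q) (hr : 0 ≤ r)
    (hv : ‖v 0‖ ^ 2 + ‖v 1‖ ^ 2 ≤ 1 + q) (hw : ‖w 0‖ ^ 2 + ‖w 1‖ ^ 2 ≤ r ^ 2) :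
    ‖∑ i, (tens (Function.update (fun _ => v) i w) : State n)‖ ≤ n * (r * Real.exp (n * q)) := by
  have h1 : ∀ i : Fin n, ‖(tens (Function.update (fun _ => v) i w) : State n)‖
      ≤ r * Real.exp (n * q) := fun i => by
    refine (sq_le_sq₀ (norm_nonneg _) (by positivity)).mp ?_
    rw [norm_sq_tens, ← Finset.mul_prod_erase _ _ (Finset.mem_univ i), Function.update_self, mul_pow]
    have h2 : ∏ j ∈ Finset.univ.erase i, (‖Function.update (fun _ => v) i w j 0‖ ^ 2
        + ‖Function.update (fun _ => v) i w j 1‖ ^ 2) = (‖v 0‖ ^ 2 + ‖v 1‖ ^ 2) ^ (n - 1) := by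
      rw [Finset.prod_congr rfl fun j hj => by
        rw [Function.update_of_ne (Finset.ne_of_mem_erase hj)], Finset.prod_const,
        Finset.card_erase_of_mem (Finset.mem_univ i), Finset.card_univ, Fintype.card_fin]
    rw [h2]
    have h3 : (‖v 0‖ ^ 2 + ‖v 1‖ ^ 2) ^ (n - 1) ≤ Real.exp (n * q) ^ 2 :=
      calc (‖v 0‖ ^ 2 + ‖v 1‖ ^ 2) ^ (n - 1) ≤ (1 + q) ^ (n - 1) := by gcongr
        _ ≤ (1 + q) ^ n := pow_le_pow_right₀ (by linarith) (Nat.sub_le n 1)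
        _ ≤ Real.exp (n * q) := one_add_pow_le_exp hq n
        _ ≤ Real.exp (n * q) ^ 2 :=
          le_self_pow₀ (Real.one_le_exp (by positivity)) two_ne_zero
    gcongr
  refine (norm_sum_le _ _).trans ((Finset.sum_le_sum fun i _ => h1 i).trans ?_)
  simp

/-- The `H0` part is the `H1` part conjugated by the Walsh transform, which is isometric and keeps
product states product. `hw2` bounds the probability of 1 in the Hadamard basis. -/
theorem norm_H_trunc_sub_le {n : ℕ} (hn : 0 < n) {θ D q s : ℝ} (hD : 0 ≤ D)
    (h : n / 2 + D ≤ θ) (hq : 0 ≤ q) (hs : s ∈ Set.Icc (0 : ℝ) 1) {w : Fin 2 → ℂ}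
    (hw : ‖w 0‖ ^ 2 + ‖w 1‖ ^ 2 ≤ 1 + q) (hw1 : ‖w 1‖ ^ 2 ≤ 1 / 2 + q)
    (hw2 : ‖w 0 - w 1‖ ^ 2 / 2 ≤ 1 / 2 + q) :
    ‖(H n θ s).toEuclideanLin (tens fun _ => w) - (H n n s).toEuclideanLin (tens fun _ => w)‖
      ≤ n * Real.exp (-(D ^ 2 / n) + n * q) := by
  have hc : ‖((1 / Real.sqrt 2 : ℝ) : ℂ)‖ ^ 2 = 1 / 2 := by
    rw [Complex.norm_real, Real.norm_eq_abs, sq_abs, div_pow, Real.sq_sqrt (by norm_num)]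
    norm_num
  have h1 := norm_H1_trunc_sub_le hn hD h hq (v := fun _ => w) (fun _ => hw) fun _ => hw1
  have h2 := norm_H1_trunc_sub_le hn hD h hq (v := fun _ => hadamard *ᵥ w)
    (fun _ => by
      have := parallelogram_law_with_norm ℝ (w 0) (w 1)
      rw [hadamard_mulVec]
      simp only [Matrix.cons_val_zero, Matrix.cons_val_one, norm_mul, mul_pow, hc]
      linarith)
    (fun _ => by
      rw [hadamard_mulVec]
      simp only [Matrix.cons_val_zero, Matrix.cons_val_one, norm_mul, mul_pow, hc]
      linarith)
  rw [H_apply, H_apply, H0_apply, H0_apply, walsh_tens]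
  set x : State n := tens fun _ => w
  set y : State n := tens fun _ => hadamard *ᵥ w
  have h3 : ∀ a b c d : State n, ∀ p r : ℂ, p • a + r • b - (p • c + r • d)
      = p • (a - c) + r • (b - d) := fun a b c d p r => by module
  rw [h3, ← map_sub]
  refine (norm_add_le _ _).trans ?_
  rw [norm_smul, norm_smul, norm_walsh, Complex.norm_real, Complex.norm_real,
    Real.norm_of_nonneg hs.1, Real.norm_of_nonneg (sub_nonneg.mpr hs.2)]
  nlinarith [mul_le_mul_of_nonneg_left h1 hs.1,
    mul_le_mul_of_nonneg_left h2 (sub_nonneg.mpr hs.2)]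

/-! ### First-order adiabatic approximation for a single qubit -/

/-- The gap of the untruncated single-qubit Hamiltonian. -/
def qubitGap (s : ℝ) : ℝ := Real.sqrt (s ^ 2 + (1 - s) ^ 2)

/-- Half the angle of the single-qubit ground state on the Bloch sphere. -/
def halfAngle (s : ℝ) : ℝ := (Real.pi / 4 + Real.arctan (1 - 2 * s)) / 2

theorem half_le_sq_add_sq (s : ℝ) : 1 / 2 ≤ s ^ 2 + (1 - s) ^ 2 := by
  nlinarith [sq_nonneg (2 * s - 1)]

theorem qubitGap_sq (s : ℝ) : qubitGap s ^ 2 = s ^ 2 + (1 - s) ^ 2 :=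
  Real.sq_sqrt (by positivity)

theorem half_le_qubitGap_sq (s : ℝ) : 1 / 2 ≤ qubitGap s ^ 2 := by
  rw [qubitGap_sq]; exact half_le_sq_add_sq s

theorem qubitGap_pos (s : ℝ) : 0 < qubitGap s :=
  Real.sqrt_pos.mpr (by linarith [half_le_sq_add_sq s])

theorem continuous_qubitGap : Continuous qubitGap := by
  unfold qubitGap
  fun_prop

theorem hasDerivAt_qubitGap (s : ℝ) : HasDerivAt qubitGap ((2 * s - 1) / qubitGap s) s := by
  have h1 : HasDerivAt (fun s : ℝ => s ^ 2 + (1 - s) ^ 2) (2 * (2 * s - 1)) s := by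
    refine ((hasDerivAt_pow 2 s).add (((hasDerivAt_id s).const_sub 1).pow 2)).congr_deriv ?_
    simp
    ring
  refine (h1.sqrt (by linarith [half_le_sq_add_sq s])).congr_deriv ?_
  rw [mul_div_mul_left _ _ two_ne_zero]
  rfl

theorem hasDerivAt_halfAngle (s : ℝ) :
    HasDerivAt halfAngle (-(1 / (2 * qubitGap s ^ 2))) s := by
  have h1 : HasDerivAt (fun s : ℝ => 1 - 2 * s) (-2) s := by
    refine (((hasDerivAt_id s).const_mul 2).const_sub 1).congr_deriv ?_
    simp
  refine ((h1.arctan.const_add (Real.pi / 4)).div_const 2).congr_deriv ?_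
  have h2 : 1 + (1 - 2 * s) ^ 2 = 2 * qubitGap s ^ 2 := by rw [qubitGap_sq]; ring
  rw [h2]
  have := qubitGap_pos s
  field_simp

theorem sqrt_one_add_sq_eq (s : ℝ) :
    Real.sqrt (1 + (1 - 2 * s) ^ 2) = Real.sqrt 2 * qubitGap s := by
  rw [qubitGap, ← Real.sqrt_mul (by norm_num)]
  congr 1
  ring

/-- The Bloch angle has tangent (1 - s)/s, and subtracting π/4 from the angle turns this into 1 -
2s. That form avoids the pole at s = 0. -/
theorem qubitGap_mul_cos (s : ℝ) : qubitGap s * Real.cos (2 * halfAngle s) = s := by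
  have h2 : Real.sqrt 2 ≠ 0 := by positivity
  have := (qubitGap_pos s).ne'
  rw [halfAngle, mul_div_cancel₀ _ two_ne_zero, Real.cos_add, Real.cos_arctan, Real.sin_arctan,
    Real.cos_pi_div_four, Real.sin_pi_div_four, sqrt_one_add_sq_eq]
  field_simp
  ring

theorem qubitGap_mul_sin (s : ℝ) : qubitGap s * Real.sin (2 * halfAngle s) = 1 - s := by
  have h2 : Real.sqrt 2 ≠ 0 := by positivity
  have := (qubitGap_pos s).ne'
  rw [halfAngle, mul_div_cancel₀ _ two_ne_zero, Real.sin_add, Real.cos_arctan, Real.sin_arctan,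
    Real.cos_pi_div_four, Real.sin_pi_div_four, sqrt_one_add_sq_eq]
  field_simp
  ring

/-- The amplitude of `|0⟩` in the single-qubit ground state. -/
def gc (s : ℝ) : ℝ := Real.cos (halfAngle s)

/-- The amplitude of `|1⟩` in the single-qubit ground state. -/
def gs (s : ℝ) : ℝ := Real.sin (halfAngle s)

theorem gc_sq_add_gs_sq (s : ℝ) : gc s ^ 2 + gs s ^ 2 = 1 := Real.cos_sq_add_sin_sq _

theorem qubitGap_mul_sub (s : ℝ) : qubitGap s * (gc s ^ 2 - gs s ^ 2) = s := by
  rw [gc, gs, ← Real.cos_two_mul', qubitGap_mul_cos]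

theorem qubitGap_mul_mul (s : ℝ) : qubitGap s * (2 * gs s * gc s) = 1 - s := by
  rw [gc, gs, ← Real.sin_two_mul, qubitGap_mul_sin]

theorem hasDerivAt_gc (s : ℝ) : HasDerivAt gc (gs s / (2 * qubitGap s ^ 2)) s := by
  refine (hasDerivAt_halfAngle s).cos.congr_deriv ?_
  rw [gs]
  ring

theorem hasDerivAt_gs (s : ℝ) : HasDerivAt gs (-(gc s / (2 * qubitGap s ^ 2))) s := by
  refine (hasDerivAt_halfAngle s).sin.congr_deriv ?_
  rw [gc]
  ring

/-- The coefficient of the first-order correction to the adiabatic approximation. -/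
def corr (s : ℝ) : ℝ := 1 / (2 * qubitGap s ^ 3)

/-- The derivative of `corr`. -/
def corrDeriv (s : ℝ) : ℝ := -(3 * (2 * s - 1) / (2 * qubitGap s ^ 5))

theorem hasDerivAt_corr (s : ℝ) : HasDerivAt corr (corrDeriv s) s := by
  have h0 := (qubitGap_pos s).ne'
  have h1 := (((hasDerivAt_qubitGap s).pow 3).const_mul 2).fun_inv (by simpa using h0)
  have h2 : corr = fun s => (2 * qubitGap s ^ 3)⁻¹ := by
    ext s
    rw [corr, one_div]
  rw [h2]
  refine h1.congr_deriv ?_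
  rw [corrDeriv]
  simp only [Pi.pow_apply]
  field_simp
  push_cast
  ring

theorem corr_sq_le (s : ℝ) : corr s ^ 2 ≤ 2 := by
  have h := half_le_qubitGap_sq s
  rw [corr, div_pow, div_le_iff₀ (by have := qubitGap_pos s; positivity)]
  have h1 : (2 * qubitGap s ^ 3) ^ 2 = 4 * (qubitGap s ^ 2) ^ 3 := by ring
  have h2 : (1 / 2 : ℝ) ^ 3 ≤ (qubitGap s ^ 2) ^ 3 := by gcongr
  rw [h1]
  linarith

/-- From `qubitGap s ^ 2 ≥ 1/2` the terms are at most 72 and 2; 81 is a convenient square above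
their sum. -/
theorem corrDeriv_sq_add_le {s : ℝ} (hs : s ∈ Set.Icc (0 : ℝ) 1) :
    corrDeriv s ^ 2 + (corr s / (2 * qubitGap s ^ 2)) ^ 2 ≤ 81 := by
  have h := half_le_qubitGap_sq s
  have hp := qubitGap_pos s
  have h1 : corrDeriv s ^ 2 ≤ 72 := by
    rw [corrDeriv, neg_sq, div_pow, div_le_iff₀ (by positivity)]
    have h1 : (2 * qubitGap s ^ 5) ^ 2 = 4 * (qubitGap s ^ 2) ^ 5 := by ring
    have h2 : (1 / 2 : ℝ) ^ 5 ≤ (qubitGap s ^ 2) ^ 5 := by gcongr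
    rw [h1]
    nlinarith [hs.1, hs.2]
  have h2 : (corr s / (2 * qubitGap s ^ 2)) ^ 2 ≤ 2 := by
    rw [div_pow, div_le_iff₀ (by positivity)]
    nlinarith [corr_sq_le s]
  linarith

/-- The first-order adiabatic approximation of the evolution of a single qubit, with phase `p`. -/
def ansatz (τ : ℝ) (p : ℂ) (s : ℝ) : Fin 2 → ℂ :=
  ![p * (((gc s : ℝ) : ℂ) + Complex.I * ((corr s * gs s / τ : ℝ) : ℂ)),
    p * (((gs s : ℝ) : ℂ) + Complex.I * ((-(corr s * gc s / τ) : ℝ) : ℂ))]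

/-- The residual of `ansatz` in the Schrödinger equation. -/
def residual (τ : ℝ) (p : ℂ) (s : ℝ) : Fin 2 → ℂ :=
  ![p * (Complex.I * (((corrDeriv s * gs s - corr s / (2 * qubitGap s ^ 2) * gc s) / τ ^ 2 : ℝ) : ℂ)),
    p * (Complex.I *
      ((-((corrDeriv s * gc s + corr s / (2 * qubitGap s ^ 2) * gs s) / τ ^ 2) : ℝ) : ℂ))]

theorem norm_sq_add_I_mul (x y : ℝ) : ‖(x : ℂ) + Complex.I * (y : ℂ)‖ ^ 2 = x ^ 2 + y ^ 2 := by
  rw [← Complex.normSq_eq_norm_sq, mul_comm, Complex.normSq_add_mul_I]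

theorem norm_sq_ansatz_zero {τ : ℝ} {p : ℂ} (hp : ‖p‖ = 1) (s : ℝ) :
    ‖ansatz τ p s 0‖ ^ 2 = gc s ^ 2 + (corr s * gs s / τ) ^ 2 := by
  rw [ansatz, Matrix.cons_val_zero, norm_mul, hp, one_mul, norm_sq_add_I_mul]

theorem norm_sq_ansatz_one {τ : ℝ} {p : ℂ} (hp : ‖p‖ = 1) (s : ℝ) :
    ‖ansatz τ p s 1‖ ^ 2 = gs s ^ 2 + (corr s * gc s / τ) ^ 2 := by
  rw [ansatz, Matrix.cons_val_one, Matrix.cons_val_zero, norm_mul, hp, one_mul, norm_sq_add_I_mul,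
    neg_sq]

theorem corr_div_sq_le (s τ : ℝ) : (corr s / τ) ^ 2 ≤ 2 / τ ^ 2 := by
  rw [div_pow]
  gcongr
  exact corr_sq_le s

theorem norm_sq_ansatz_add_le {τ : ℝ} {p : ℂ} (hp : ‖p‖ = 1) (s : ℝ) :
    ‖ansatz τ p s 0‖ ^ 2 + ‖ansatz τ p s 1‖ ^ 2 ≤ 1 + 2 / τ ^ 2 := by
  rw [norm_sq_ansatz_zero hp, norm_sq_ansatz_one hp]
  have h1 := gc_sq_add_gs_sq s
  have h2 : gc s ^ 2 + (corr s * gs s / τ) ^ 2 + (gs s ^ 2 + (corr s * gc s / τ) ^ 2)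
      = (gc s ^ 2 + gs s ^ 2) * (1 + (corr s / τ) ^ 2) := by ring
  rw [h2, h1]
  linarith [corr_div_sq_le s τ]

/-- The ground state favours |0⟩ because its Bloch cosine is s divided by the gap, nonnegative for s
≥ 0. The correction adds at most `(corr s / τ) ^ 2`. -/
theorem norm_sq_ansatz_one_le {τ : ℝ} {p : ℂ} (hp : ‖p‖ = 1) {s : ℝ}
    (hs : s ∈ Set.Icc (0 : ℝ) 1) : ‖ansatz τ p s 1‖ ^ 2 ≤ 1 / 2 + 2 / τ ^ 2 := by
  rw [norm_sq_ansatz_one hp]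
  have h1 := gc_sq_add_gs_sq s
  have h2 : 0 ≤ gc s ^ 2 - gs s ^ 2 :=
    nonneg_of_mul_nonneg_right (by rw [qubitGap_mul_sub]; exact hs.1) (qubitGap_pos s)
  have h3 : (corr s * gc s / τ) ^ 2 = (corr s / τ) ^ 2 * gc s ^ 2 := by ring
  rw [h3]
  nlinarith [corr_div_sq_le s τ, sq_nonneg (gc s), sq_nonneg (gs s), sq_nonneg (corr s / τ)]

/-- The same in the Hadamard basis, where s ≤ 1 gives a nonnegative Bloch sine. -/
theorem norm_sq_ansatz_sub_le {τ : ℝ} {p : ℂ} (hp : ‖p‖ = 1) {s : ℝ}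
    (hs : s ∈ Set.Icc (0 : ℝ) 1) :
    ‖ansatz τ p s 0 - ansatz τ p s 1‖ ^ 2 / 2 ≤ 1 / 2 + 2 / τ ^ 2 := by
  have h0 : ansatz τ p s 0 - ansatz τ p s 1 = p * (((gc s - gs s : ℝ) : ℂ)
      + Complex.I * ((corr s / τ * (gs s + gc s) : ℝ) : ℂ)) := by
    simp only [ansatz, Matrix.cons_val_zero, Matrix.cons_val_one]
    push_cast
    ring
  rw [h0, norm_mul, hp, one_mul, norm_sq_add_I_mul]
  have h1 := gc_sq_add_gs_sq s
  have h2 : 0 ≤ 2 * gs s * gc s :=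
    nonneg_of_mul_nonneg_right (by rw [qubitGap_mul_mul]; linarith [hs.2]) (qubitGap_pos s)
  have h3 : (corr s / τ * (gs s + gc s)) ^ 2 = (corr s / τ) ^ 2 * (gs s + gc s) ^ 2 := by ring
  have h4 : (gs s + gc s) ^ 2 ≤ 2 := by nlinarith [sq_nonneg (gc s - gs s)]
  rw [h3]
  nlinarith [mul_le_mul_of_nonneg_left h4 (sq_nonneg (corr s / τ)), corr_div_sq_le s τ]

theorem norm_sq_residual_le {τ : ℝ} {p : ℂ} (hp : ‖p‖ = 1) {s : ℝ}
    (hs : s ∈ Set.Icc (0 : ℝ) 1) :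
    ‖residual τ p s 0‖ ^ 2 + ‖residual τ p s 1‖ ^ 2 ≤ (9 / τ ^ 2) ^ 2 := by
  simp only [residual, Matrix.cons_val_zero, Matrix.cons_val_one, norm_mul, hp, one_mul,
    Complex.norm_I, Complex.norm_real, Real.norm_eq_abs, sq_abs]
  have h1 := gc_sq_add_gs_sq s
  set d := corr s / (2 * qubitGap s ^ 2) with hd
  have h2 : ((corrDeriv s * gs s - d * gc s) / τ ^ 2) ^ 2
      + (-((corrDeriv s * gc s + d * gs s) / τ ^ 2)) ^ 2
      = (gc s ^ 2 + gs s ^ 2) * ((corrDeriv s ^ 2 + d ^ 2) / (τ ^ 2) ^ 2) := by ring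
  rw [h2, h1, one_mul, div_pow 9]
  exact div_le_div_of_nonneg_right ((corrDeriv_sq_add_le hs).trans (by norm_num)) (by positivity)

theorem qubitGap_mul_corr (s : ℝ) : qubitGap s * corr s = 1 / (2 * qubitGap s ^ 2) := by
  have := (qubitGap_pos s).ne'
  rw [corr]
  field_simp

/-- The ground vector (gc, gs) has s-derivative (gs, -gc)/(2·gap²), a multiple of the excited
vector. Adding i·corr/τ times the excited vector cancels this at order 1/τ exactly when gap·corr =
1/(2·gap²), which is `e4`. What remains is the derivative of the correction, of order 1/τ². -/
theorem hasDerivAt_ansatz {τ t : ℝ} {p : ℝ → ℂ}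
    (hp : HasDerivAt p (-Complex.I * (((1 - qubitGap (t / τ)) / 2 : ℝ) : ℂ) * p t) t) (b : Fin 2) :
    HasDerivAt (fun t => ansatz τ (p t) (t / τ) b)
      (-Complex.I * qubitH (t / τ) (ansatz τ (p t) (t / τ)) b + residual τ (p t) (t / τ) b) t := by
  have hdiv : HasDerivAt (fun t : ℝ => t / τ) (1 / τ) t := (hasDerivAt_id t).div_const τ
  set s := t / τ with hs
  have hc : HasDerivAt (fun t => gc (t / τ)) (gs s / (2 * qubitGap s ^ 2) * (1 / τ)) t :=
    HasDerivAt.comp (h₂ := gc) t (hasDerivAt_gc s) hdiv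
  have hg : HasDerivAt (fun t => gs (t / τ)) (-(gc s / (2 * qubitGap s ^ 2)) * (1 / τ)) t :=
    HasDerivAt.comp (h₂ := gs) t (hasDerivAt_gs s) hdiv
  have hk : HasDerivAt (fun t => corr (t / τ)) (corrDeriv s * (1 / τ)) t :=
    HasDerivAt.comp (h₂ := corr) t (hasDerivAt_corr s) hdiv
  have e1 := gc_sq_add_gs_sq s
  have e2 := qubitGap_mul_sub s
  have e3 := qubitGap_mul_mul s
  have e4 := congrArg Complex.ofReal (qubitGap_mul_corr s)
  -- `f1` and `f2` are the two components of the eigenvalue equation for the ground vector, energy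
  -- (1 - gap)/2; `f3` and `f4` are those for the excited vector (gs, -gc), energy (1 + gap)/2.
  have f1 : (1 - s) * (gc s - gs s) = (1 - qubitGap s) * gc s := by
    linear_combination gc s * e2 + gs s * e3 - qubitGap s * gc s * e1
  have f2 : (1 - s) * (gs s - gc s) / 2 + s * gs s = (1 - qubitGap s) / 2 * gs s := by
    linear_combination (-gs s * e2 + gc s * e3 - qubitGap s * gs s * e1) / 2
  have f3 : (1 - s) * (gs s + gc s) = (1 + qubitGap s) * gs s := by
    linear_combination gs s * e2 - gc s * e3 + qubitGap s * gs s * e1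
  have f4 : (1 - s) * (gs s + gc s) / 2 + s * gc s = (1 + qubitGap s) / 2 * gc s := by
    linear_combination (-gc s * e2 - gs s * e3 + qubitGap s * gc s * e1) / 2
  replace f1 := congrArg Complex.ofReal f1
  replace f2 := congrArg Complex.ofReal f2
  replace f3 := congrArg Complex.ofReal f3
  replace f4 := congrArg Complex.ofReal f4
  push_cast at e4 f1 f2 f3 f4
  have d0 : HasDerivAt (fun t => ansatz τ (p t) (t / τ) 0) _ t := hp.fun_mul
    (hc.ofReal_comp.fun_add (((hk.fun_mul hg).div_const τ).ofReal_comp.const_mul Complex.I))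
  have d1 : HasDerivAt (fun t => ansatz τ (p t) (t / τ) 1) _ t := hp.fun_mul
    (hg.ofReal_comp.fun_add (((hk.fun_mul hc).div_const τ).fun_neg.ofReal_comp.const_mul Complex.I))
  fin_cases b
  · refine d0.congr_deriv ?_
    simp only [qubitH, residual, ansatz, Fin.zero_eta, Matrix.cons_val_zero,
      Matrix.cons_val_one, Pi.add_apply, Pi.smul_apply, smul_eq_mul, ← hs]
    push_cast
    linear_combination (Complex.I * p t / 2) * f1 - (p t * corr s / (2 * τ)) * f3
      - (p t * gs s / τ) * e4
      + (-((1 - qubitGap s) / 2) * p t * corr s * gs s / τ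
        + p t * corr s * (1 - s) * (gc s + gs s) / (2 * τ)) * Complex.I_sq
  · refine d1.congr_deriv ?_
    simp only [qubitH, residual, ansatz, Fin.mk_one, Matrix.cons_val_zero,
      Matrix.cons_val_one, Pi.add_apply, Pi.smul_apply, smul_eq_mul, ← hs]
    push_cast
    linear_combination Complex.I * p t * f2 + (p t * corr s / τ) * f4
      + (p t * gc s / τ) * e4
      + ((1 - qubitGap s) / 2 * p t * corr s * gc s / τ
        - p t * corr s / τ * ((1 - s) * (gs s + gc s) / 2 + s * gc s)) * Complex.I_sq

theorem gc_zero_and_gs_zero : gc 0 = 1 / Real.sqrt 2 ∧ gs 0 = 1 / Real.sqrt 2 := by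
  have h : halfAngle 0 = Real.pi / 4 := by
    simp only [halfAngle, mul_zero, sub_zero, Real.arctan_one]
    ring
  have h2 : Real.sqrt 2 / 2 = 1 / Real.sqrt 2 := by
    rw [div_eq_div_iff two_ne_zero (by positivity), Real.mul_self_sqrt (by norm_num), one_mul]
  rw [gc, gs, h, Real.cos_pi_div_four, Real.sin_pi_div_four, h2]
  simp

theorem gc_one_and_gs_one : gc 1 = 1 ∧ gs 1 = 0 := by
  have h : halfAngle 1 = 0 := by
    have : (1 : ℝ) - 2 * 1 = -1 := by norm_num
    rw [halfAngle, this, Real.arctan_neg, Real.arctan_one]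
    ring
  rw [gc, gs, h]
  simp

theorem exists_phase (τ : ℝ) : ∃ p : ℝ → ℂ, p 0 = 1 ∧ (∀ t, ‖p t‖ = 1) ∧
    ∀ t, HasDerivAt p (-Complex.I * (((1 - qubitGap (t / τ)) / 2 : ℝ) : ℂ) * p t) t := by
  have hcont : Continuous fun t : ℝ => (1 - qubitGap (t / τ)) / 2 := by
    have := continuous_qubitGap
    fun_prop
  refine ⟨fun t => Complex.exp (((-∫ x in (0 : ℝ)..t, (1 - qubitGap (x / τ)) / 2 : ℝ) : ℂ)
    * Complex.I), by simp, fun t => Complex.norm_exp_ofReal_mul_I _, fun t => ?_⟩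
  have h1 := (hcont.integral_hasStrictDerivAt 0 t).hasDerivAt.fun_neg
  refine (h1.ofReal_comp.mul_const Complex.I).cexp.congr_deriv ?_
  push_cast
  ring

theorem inner_zeroState_tens_ansatz {n : ℕ} (τ : ℝ) {p : ℂ} (hp : ‖p‖ = 1) :
    ‖inner ℂ (zeroState n) (tens fun _ => ansatz τ p 1)‖ = 1 := by
  rw [zeroState, inner_tens]
  simp [ansatz, gc_one_and_gs_one.1, gc_one_and_gs_one.2, hp]

/-- At s = 0 the correction is orthogonal to the ground vector in each qubit, so the overlap with
`plusState n` is exactly 1 and the squared distance is the excess of the squared norm over 1. -/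
theorem norm_tens_ansatz_sub_plusState_le {n : ℕ} {τ : ℝ} :
    ‖tens (fun _ => ansatz τ 1 0) - plusState n‖ ^ 2 ≤ Real.exp (n * (2 / τ ^ 2)) - 1 := by
  obtain ⟨h1, h2⟩ := gc_zero_and_gs_zero
  have hinner : inner ℂ (plusState n) (tens fun _ => ansatz τ 1 0) = 1 := by
    rw [plusState_eq_tens, inner_tens]
    refine Finset.prod_eq_one fun i _ => ?_
    have h3 := one_div_sqrt_two_sq
    simp only [ansatz, h1, h2, Matrix.cons_val_zero, Matrix.cons_val_one, one_mul,
      ← starRingEnd_apply, Complex.conj_ofReal]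
    push_cast at h3 ⊢
    linear_combination 2 * h3
  have hnorm : ‖(tens fun _ => ansatz τ 1 0 : State n)‖ ^ 2 ≤ Real.exp (n * (2 / τ ^ 2)) := by
    rw [norm_sq_tens, Finset.prod_const, Finset.card_univ, Fintype.card_fin]
    refine le_trans ?_ (one_add_pow_le_exp (by positivity) n)
    exact pow_le_pow_left₀ (by positivity) (norm_sq_ansatz_add_le norm_one 0) n
  have h4 := @norm_sub_sq ℂ _ _ _ _ (tens fun _ => ansatz τ 1 0) (plusState n)
  rw [← inner_conj_symm, hinner, norm_plusState] at h4
  simp at h4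
  linarith

/-! ### Large thresholds: success -/

/-- Three errors are subtracted: the initial mismatch of the ansatz, the truncation, and the
adiabatic residual, the last two accumulated over time τ. At s = 1 the ansatz overlaps the target
with modulus exactly 1. -/
theorem IsAdiabaticEvolution.one_sub_le_overlap {n : ℕ} (hn : 0 < n) {θ τ D : ℝ}
    {ψ : ℝ → State n} {α : State n} (h : IsAdiabaticEvolution n θ τ ψ)
    (hα : IsGroundState (H1 n θ) α) (hτ : 0 < τ) (hD : 0 ≤ D) (hθ : n / 2 + D ≤ θ) :
    1 - (Real.sqrt (Real.exp (n * (2 / τ ^ 2)) - 1)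
      + (n * Real.exp (-(D ^ 2 / n) + n * (2 / τ ^ 2))
        + n * (9 / τ ^ 2 * Real.exp (n * (2 / τ ^ 2)))) * τ) ≤ ‖inner ℂ α (ψ τ)‖ := by
  have hn' : (0 : ℝ) < n := by exact_mod_cast hn
  have hθ0 : 0 < θ := by linarith
  obtain ⟨c, hc, hψ0⟩ := h.initial.eq_smul_plusState hθ0
  obtain ⟨a, ha, rfl⟩ := hα.eq_smul_zeroState hθ0
  obtain ⟨p, hp0, hp1, hp⟩ := exists_phase τ
  set q : ℝ := 2 / τ ^ 2 with hq
  have hq0 : 0 ≤ q := by positivity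
  set x : ℝ → State n := fun t => tens fun _ => ansatz τ (p t) (t / τ) with hx
  set y : ℝ → State n := fun t =>
    ∑ i, tens (Function.update (fun _ => ansatz τ (p t) (t / τ)) i (residual τ (p t) (t / τ)))
    with hy
  have hx' : ∀ t, HasDerivAt x
      (-Complex.I • (H n n (t / τ)).toEuclideanLin (x t) + y t) t := fun t =>
    hasDerivAt_tens_of_schrodinger (hasDerivAt_ansatz (hp t))
  have key := norm_sub_le_of_schrodinger (fun t => isHermitian_H n θ (t / τ)) hτ.le
    (φ := fun t => c • x t)
    (ρ := fun t => c • (Complex.I • ((H n θ (t / τ)).toEuclideanLin (x t)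
      - (H n n (t / τ)).toEuclideanLin (x t)) + y t))
    (ε := n * Real.exp (-(D ^ 2 / n) + n * q) + n * (9 / τ ^ 2 * Real.exp (n * q)))
    h.schrodinger
    (fun t _ => by
      refine ((hx' t).const_smul c).hasDerivWithinAt.congr_deriv ?_
      rw [map_smul]
      module)
    (fun t ht => by
      have hs : t / τ ∈ Set.Icc (0 : ℝ) 1 :=
        ⟨div_nonneg ht.1 hτ.le, (div_le_one hτ).mpr ht.2⟩
      rw [norm_smul, hc, one_mul]
      refine (norm_add_le _ _).trans (add_le_add ?_ ?_)
      · rw [norm_smul, Complex.norm_I, one_mul]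
        exact norm_H_trunc_sub_le hn hD hθ hq0 hs (norm_sq_ansatz_add_le (hp1 t) _)
          (norm_sq_ansatz_one_le (hp1 t) hs) (norm_sq_ansatz_sub_le (hp1 t) hs)
      · exact norm_sum_tens_update_le hq0 (by positivity) (norm_sq_ansatz_add_le (hp1 t) _)
          (norm_sq_residual_le (hp1 t) hs))
  have h0 : ‖ψ 0 - c • x 0‖ ≤ Real.sqrt (Real.exp (n * q) - 1) := by
    rw [hψ0, ← smul_sub, norm_smul, hc, one_mul, norm_sub_rev, hx]
    refine Real.le_sqrt_of_sq_le ?_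
    simp only [hp0, zero_div]
    exact norm_tens_ansatz_sub_plusState_le
  have h1 : ‖inner ℂ (zeroState n) (c • x τ)‖ = 1 := by
    rw [inner_smul_right, norm_mul, hc, one_mul, hx]
    simp only [div_self hτ.ne']
    exact inner_zeroState_tens_ansatz τ (hp1 τ)
  have h2 := norm_inner_le_norm (𝕜 := ℂ) (zeroState n) (ψ τ - c • x τ)
  rw [norm_zeroState, one_mul, inner_sub_right] at h2
  have h3 := norm_sub_norm_le (inner ℂ (zeroState n) (c • x τ)) (inner ℂ (zeroState n) (ψ τ))
  rw [norm_sub_rev] at h3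
  rw [inner_smul_left, norm_mul, RCLike.norm_conj, ha, one_mul]
  linarith

theorem succeeds_of_le {θ : ℕ → ℝ}
    (hθ : ∀ᶠ n : ℕ in atTop,
      (n : ℝ) / 2 + Real.sqrt (40 * (n : ℝ) * Real.log (n : ℝ)) ≤ θ n) :
    Succeeds θ fun n : ℕ => (n : ℝ) ^ 4 := by
  intro ψ α hψ hα
  -- The overlap is bounded below by the constant 1/2, so degree 0 suffices.
  refine ⟨0, IsBigO.of_bound 2 ?_⟩
  filter_upwards [hψ, hα, hθ, eventually_ge_atTop 10] with n hψn hαn hθn hn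
  have hn10 : (10 : ℝ) ≤ n := by exact_mod_cast hn
  have hn' : (0 : ℝ) < n := by linarith
  have hlog := Real.log_natCast_nonneg n
  have key := hψn.one_sub_le_overlap (by omega) hαn (by positivity) (Real.sqrt_nonneg _) hθn
  have hexp : Real.exp (-(Real.sqrt (40 * (n : ℝ) * Real.log n) ^ 2 / n)) = ((n : ℝ) ^ 40)⁻¹ := by
    rw [Real.sq_sqrt (by positivity), Real.exp_neg]
    congr 1
    have : 40 * (n : ℝ) * Real.log n / n = (40 : ℕ) * Real.log n := by
      push_cast
      field_simp
    rw [this, Real.exp_nat_mul, Real.exp_log hn']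
  rw [Real.exp_add, hexp] at key
  set e := Real.exp (n * (2 / ((n : ℝ) ^ 4) ^ 2)) with he
  have he1 : e ≤ 1 + 1 / 16 := by
    have h1 : n * (2 / ((n : ℝ) ^ 4) ^ 2) ≤ 1 / 32 := by
      have h2 : n * (2 / ((n : ℝ) ^ 4) ^ 2) = 2 / (n : ℝ) ^ 7 := by field_simp
      have h3 : (10 : ℝ) ^ 7 ≤ (n : ℝ) ^ 7 := by gcongr
      rw [h2, div_le_iff₀ (by positivity)]
      linarith
    have h2 := Real.abs_exp_sub_one_le (x := n * (2 / ((n : ℝ) ^ 4) ^ 2))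
      (by rw [abs_of_nonneg (by positivity)]; linarith)
    rw [abs_of_nonneg (a := n * (2 / ((n : ℝ) ^ 4) ^ 2)) (by positivity)] at h2
    linarith [le_abs_self (e - 1)]
  have he0 : 0 < e := Real.exp_pos _
  have h1 : Real.sqrt (e - 1) ≤ 1 / 4 :=
    Real.sqrt_le_iff.mpr ⟨by norm_num, by linarith⟩
  -- The constant 40 makes the tail factor n^(-40), leaving n^(-35) after the factor n and time n⁴;
  -- the adiabatic residual leaves 9/n³.
  have h2 : (n * (((n : ℝ) ^ 40)⁻¹ * e) + n * (9 / ((n : ℝ) ^ 4) ^ 2 * e)) * (n : ℝ) ^ 4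
      = (1 / (n : ℝ) ^ 35 + 9 / (n : ℝ) ^ 3) * e := by field_simp
  have h3 : 1 / (n : ℝ) ^ 35 ≤ 1 / 100 := by
    have : (10 : ℝ) ^ 35 ≤ (n : ℝ) ^ 35 := by gcongr
    exact one_div_le_one_div_of_le (by norm_num) (by linarith)
  have h4 : 9 / (n : ℝ) ^ 3 ≤ 9 / 1000 := by
    have : (10 : ℝ) ^ 3 ≤ (n : ℝ) ^ 3 := by gcongr
    exact div_le_div_of_nonneg_left (by norm_num) (by norm_num) (by linarith)
  rw [h2] at key
  rw [pow_zero, inv_one, norm_one, norm_norm]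
  nlinarith

end ThetaAdiabatic

end

theorem theorem1 :
    (∀ (c : ℝ) (θ : ℕ → ℝ), 1 < c →
      (∀ᶠ n : ℕ in atTop,
        0 < θ n ∧ θ n ≤ (n : ℝ) / 2 - Real.sqrt ((n : ℝ) * Real.log (n : ℝ) ^ c)) →
      (∀ τ : ℕ → ℝ, (∀ᶠ n : ℕ in atTop, 0 < τ n) →
        (∃ d : ℕ, τ =O[atTop] fun n : ℕ => (n : ℝ) ^ d) →
        ThetaAdiabatic.Fails θ τ) ∧
      ThetaAdiabatic.IsNegligible fun n => ThetaAdiabatic.minGap n (θ n)) ∧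
    (∀ θ : ℕ → ℝ,
      (∀ᶠ n : ℕ in atTop,
        (n : ℝ) / 2 + Real.sqrt (40 * (n : ℝ) * Real.log (n : ℝ)) ≤ θ n) →
      ThetaAdiabatic.Succeeds θ fun n : ℕ => (n : ℝ) ^ 4) := by
  refine ⟨fun c θ hc hθ => ⟨fun τ hτ hτd => ?_, ?_⟩, fun θ hθ => ?_⟩
  · exact ThetaAdiabatic.fails_of_le hc hθ hτ hτd
  · exact ThetaAdiabatic.isNegligible_minGap hc hθ
  · exact ThetaAdiabatic.succeeds_of_le hθ
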